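/- Let $(\mathcal A,\cdot)$ be a set with a binary application, written by juxtaposition and associating to the left, with elements $B, C^+, C^-, I$. Write $a\circ b := B\,a\,b$, $a^0:=I$, $a^{n+1}:=a\circ a^n$, and $a^\bullet := C^+\,I\,a$. Linked signs $\pm,\mp$ are read consistently, and each $\star$ is an arbitrary choice of sign. Application binds tighter than $\circ$, and chains of $\circ$ are bracketed to the right. $\mathcal A$ is an *extensional $\mathbf{BC^\pm I}$-algebra* if for all $a,b,c\in\mathcal A$: $B\,a\,b\,c=a\,(b\,c)$; $C^\star\,a\,b\,c=a\,c\,b$; $I\,a=a$; $C^+\,a\,b=C^-\,a\,b$; $B\,I=I$; $C^\star\,B\,I=B\,I$; $(C^\star\,B\,B)\circ(B\circ B)=(B\,B)\circ B$; $C^\pm\circ C^\mp=B\,(B\,I)$; $(C^\star\,B\,C^\pm)\circ(B\circ B)=(B\,C^\pm)\circ(B\circ B)$; $(B\,C^\pm)\circ(C^\pm\circ(B\,C^\pm))=C^\pm\circ((B\,C^\pm)\circ C^\pm)$; $(B\,B)\circ C^\pm=C^\pm\circ((B\,C^\pm)\circ B)$. It is *balanced* if it is moreover equipped with elements $\theta^+,\theta^-$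 such that, for all $a$: $(B\,\theta^\pm)\circ B=(C^\star\,B\,\theta^\pm)\circ B$; $\theta^\pm\circ\theta^\mp=B\,I$; $C^\star\,\theta^\star\,a=C^\star\,I\,a$; $B\circ\theta^\pm=\theta^\pm\circ C^\pm\circ\theta^\pm\circ C^\pm\circ B$. Let $\mathcal A$ be a balanced extensional $\mathbf{BC^\pm I}$-algebra. A *trace combinator* is an element $\mathit{Tr}$ with - (Left Tightening) $(C^\star\,B\,\mathit{Tr})\circ B=(B\,\mathit{Tr})\circ B^2$, - (Right Tightening) $(B\,\mathit{Tr})\circ(C^\star\,B\,B)\circ B=B\circ\mathit{Tr}$, - (Yanking) $\mathit{Tr}\,C^\pm=\theta^\pm$, - (Exchange) $\mathit{Tr}^2\circ(C^\star\,B\,C^-)\circ(B\,C^+)=\mathit{Tr}^2$. A *ribbon duality* is a pair $(\alpha,\beta)$ with - (Arity) $\alpha^\bullet\circ B=(B\,\alpha)\circ B^2$ and $\beta^\bullet\circ B^3=B\,\beta$, - (Duality) $\alpha\circ(B\,\beta)=B\,I$ and $(B\,\alpha)\circ\beta=B\,I$, - (Duality$_\theta$) $\alpha\circ\theta^\pm=\alpha\circ(B\,\theta^\pm)$.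 $\mathcal A$ is *traced* if it has a trace combinator, and *ribbon* if it has a ribbon duality. **Theorem.** Let $\mathcal A$ be a balanced extensional $\mathbf{BC^\pm I}$-algebra. 1. $\mathcal A$ is traced if and only if it is ribbon. 2. If $\mathit{Tr}$ is a trace combinator, then $$\alpha=\mathit{Tr}\,(\mathit{Tr}\circ(B\,\mathit{Tr})\circ(B\,C^+)\circ C^+),\qquad \beta=\mathit{Tr}\,(C^+\circ(B\,C^+)\circ(B\,B)\circ B)$$ form a ribbon duality, and $\mathit{Tr}=(C^+\,B\,\beta)\circ(B\,\alpha)\circ B$. 3. If $(\alpha,\beta)$ is a ribbon duality, then $(C^+\,B\,\beta)\circ(B\,(\alpha\circ\theta^+\circ C^+))\circ B$ is a trace combinator. In particular, if moreover $\alpha\circ\theta^+\circ C^+=\alpha$, then $(C^+\,B\,\beta)\circ(B\,\alpha)\circ B$ is a trace combinator. Algebras satisfying the equivalent conditions in 1 are called *ribbon combinatory algebras*. -/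

import Mathlib

/-- A sign, used to treat the linked double signs `±`, `∓` uniformly. -/
inductive Sgn : Type
  | plus
  | minus

/-- The opposite sign: `∓` when the given sign is `±`. -/
def Sgn.opp : Sgn → Sgn
  | Sgn.plus => Sgn.minus
  | Sgn.minus => Sgn.plus

/-- An applicative structure: a set with a binary application. -/
class ApplicativeStructure (A : Type*) where
  app : A → A → A

/-- Application, associating to the left. -/
infixl:75 " ⬝ " => ApplicativeStructure.app

/-- The signature of `BC^±I`-algebras: an applicative structure with distinguished elements
`B`, `C⁺`, `C⁻`, `I`.  The laws are in `ExtBCpmIAlgebra`. -/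
class BCpmISignature (A : Type*) extends ApplicativeStructure A where
  B : A
  C : Sgn → A
  I : A

namespace BCpmI

open BCpmISignature

/-- `a ∘ b` abbreviates `B a b`. -/
def comp {A : Type*} [BCpmISignature A] (a b : A) : A := B ⬝ a ⬝ b

/-- Powers for `∘`: `a⁰ = I` and `aⁿ⁺¹ = a ∘ aⁿ`. -/
def cpow {A : Type*} [BCpmISignature A] (a : A) : ℕ → A
  | 0 => I
  | n + 1 => comp a (cpow a n)

/-- `a^• = C⁺ I a`. By the axiom `(C2)` below this is also `C⁻ I a`. -/
def bullet {A : Type*} [BCpmISignature A] (a : A) : A := C Sgn.plus ⬝ I ⬝ a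

end BCpmI

/-- The composition `a ∘ b = B a b`, written here `a ⊚ b` and associating to the right
(application binds tighter). -/
infixr:70 " ⊚ " => BCpmI.comp

open BCpmISignature in
/-- Extensional `BC^±I`-algebras. Linked signs `±` are quantified by `s` (with `s.opp` for `∓`),
and an arbitrary choice of sign `⋆` by a separate variable `t`. -/
class ExtBCpmIAlgebra (A : Type*) extends BCpmISignature A where
  ax_B : ∀ a b c : A, B ⬝ a ⬝ b ⬝ c = a ⬝ (b ⬝ c)
  ax_C : ∀ (t : Sgn) (a b c : A), C t ⬝ a ⬝ b ⬝ c = a ⬝ c ⬝ b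
  ax_I : ∀ a : A, I ⬝ a = a
  ax_C2 : ∀ a b : A, C Sgn.plus ⬝ a ⬝ b = C Sgn.minus ⬝ a ⬝ b
  ax_lambda : (B : A) ⬝ I = I
  ax_rho : ∀ t : Sgn, (C t : A) ⬝ B ⬝ I = B ⬝ I
  ax_alpha : ∀ t : Sgn, ((C t : A) ⬝ B ⬝ B) ⊚ (B ⊚ B) = (B ⬝ B) ⊚ B
  ax_cox1 : ∀ s : Sgn, (C s : A) ⊚ C s.opp = B ⬝ (B ⬝ I)
  ax_cox2 : ∀ s t : Sgn, ((C t : A) ⬝ B ⬝ C s) ⊚ (B ⊚ B) = (B ⬝ C s) ⊚ (B ⊚ B)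
  ax_cox3 : ∀ s : Sgn, ((B : A) ⬝ C s) ⊚ (C s ⊚ (B ⬝ C s)) = C s ⊚ ((B ⬝ C s) ⊚ C s)
  ax_bc : ∀ s : Sgn, ((B : A) ⬝ B) ⊚ C s = C s ⊚ ((B ⬝ C s) ⊚ B)

open BCpmISignature in
/-- Balanced extensional `BC^±I`-algebras: `θ s` is the twist `θ⁺` or its inverse `θ⁻`. -/
class BalancedExtBCpmIAlgebra (A : Type*) extends ExtBCpmIAlgebra A where
  θ : Sgn → A
  ax_theta1 : ∀ s t : Sgn, (B ⬝ θ s) ⊚ B = (C t ⬝ B ⬝ θ s) ⊚ B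
  ax_theta2 : ∀ s : Sgn, θ s ⊚ θ s.opp = B ⬝ I
  ax_theta3 : ∀ (t t' t'' : Sgn) (a : A), C t ⬝ θ t' ⬝ a = C t'' ⬝ I ⬝ a
  ax_theta4 : ∀ s : Sgn, B ⊚ θ s = θ s ⊚ C s ⊚ θ s ⊚ C s ⊚ B

namespace BCpmI

open BCpmISignature BalancedExtBCpmIAlgebra

/-- `Tr` is a trace combinator of the balanced extensional `BC^±I`-algebra `A`. -/
structure IsTraceCombinator {A : Type*} [BalancedExtBCpmIAlgebra A] (Tr : A) : Prop where
  left_tightening : ∀ t : Sgn, (C t ⬝ B ⬝ Tr) ⊚ B = (B ⬝ Tr) ⊚ cpow B 2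
  right_tightening : ∀ t : Sgn, (B ⬝ Tr) ⊚ (C t ⬝ B ⬝ B) ⊚ B = B ⊚ Tr
  yanking : ∀ s : Sgn, Tr ⬝ C s = θ s
  exchange : ∀ t : Sgn,
    cpow Tr 2 ⊚ (C t ⬝ B ⬝ C Sgn.minus) ⊚ (B ⬝ C Sgn.plus) = cpow Tr 2

/-- The pair `α : 0 → 2`, `β : 2 → 0` is a duality. -/
structure IsDuality {A : Type*} [ExtBCpmIAlgebra A] (α β : A) : Prop where
  arity_α : bullet α ⊚ B = (B ⬝ α) ⊚ cpow B 2
  arity_β : bullet β ⊚ cpow B 3 = B ⬝ β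
  duality₁ : α ⊚ (B ⬝ β) = B ⬝ I
  duality₂ : (B ⬝ α) ⊚ β = B ⬝ I

/-- A duality that is compatible with the twist. -/
structure IsRibbonDuality {A : Type*} [BalancedExtBCpmIAlgebra A] (α β : A) : Prop
    extends IsDuality α β where
  duality_θ : ∀ s : Sgn, α ⊚ θ s = α ⊚ (B ⬝ θ s)

/-- A balanced extensional `BC^±I`-algebra is traced if it has a trace combinator. -/
def IsTraced (A : Type*) [BalancedExtBCpmIAlgebra A] : Prop :=
  ∃ Tr : A, IsTraceCombinator Tr

/-- A balanced extensional `BC^±I`-algebra is ribbon if it has a duality satisfying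
`(Duality_θ)`. -/
def IsRibbon (A : Type*) [BalancedExtBCpmIAlgebra A] : Prop :=
  ∃ α β : A, IsRibbonDuality α β

/-- The unit `α = Tr (Tr ∘ (B Tr) ∘ (B C⁺) ∘ C⁺)` built from `Tr`. -/
def unitOfTrace {A : Type*} [BCpmISignature A] (Tr : A) : A :=
  Tr ⬝ (Tr ⊚ (B ⬝ Tr) ⊚ (B ⬝ C Sgn.plus) ⊚ C Sgn.plus)

/-- The counit `β = Tr (C⁺ ∘ (B C⁺) ∘ (B B) ∘ B)` built from `Tr`. -/
def counitOfTrace {A : Type*} [BCpmISignature A] (Tr : A) : A :=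
  Tr ⬝ (C Sgn.plus ⊚ (B ⬝ C Sgn.plus) ⊚ (B ⬝ B) ⊚ B)

/-- The element `(C⁺ B β) ∘ (B α) ∘ B`; applied to `f` it gives `α ∘ (B f) ∘ β`. -/
def traceOfDuality {A : Type*} [BCpmISignature A] (α β : A) : A :=
  (C Sgn.plus ⬝ B ⬝ β) ⊚ (B ⬝ α) ⊚ B

end BCpmI

open BCpmISignature ExtBCpmIAlgebra BalancedExtBCpmIAlgebra

namespace BCpmI

section Monoid

variable {A : Type*} [ExtBCpmIAlgebra A]

theorem C_app_app_eq (s t : Sgn) (a b : A) : C s ⬝ a ⬝ b = C t ⬝ a ⬝ b := by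
  cases s <;> cases t <;> first | rfl | exact ax_C2 a b | exact (ax_C2 a b).symm

theorem comp_I (a : A) : a ⊚ I = a := by
  have h := congrArg (· ⬝ a) (ax_rho (A := A) Sgn.plus)
  simp only [ax_C, ax_lambda, ax_I] at h
  exact h

theorem I_comp (a : A) : I ⊚ a = a := by
  unfold comp
  rw [ax_lambda, ax_I]

theorem B_app_comp (a b : A) : B ⬝ (a ⊚ b) = (B ⬝ a) ⊚ (B ⬝ b) := by
  have h := congrArg (fun x => x ⬝ a ⬝ b) (ax_alpha (A := A) Sgn.plus)
  simp only [comp, ax_B, ax_C] at h ⊢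
  exact h.symm

/-- The elements of a `BC^±I`-algebra form a monoid under composition. -/
instance compMonoid : Monoid A where
  mul := comp
  one := I
  mul_assoc a b c := by
    have h := congrArg (· ⬝ c) (B_app_comp a b)
    simp only [comp, ax_B] at h
    exact h
  one_mul := I_comp
  mul_one := comp_I

theorem comp_eq_mul (a b : A) : a ⊚ b = a * b := rfl
theorem I_eq_one : (I : A) = 1 := rfl

/-- Application of `B`, which places a strand to the left of a diagram. -/
def shift : A →* A where
  toFun a := B ⬝ a
  map_one' := ax_lambda
  map_mul' := B_app_comp

theorem B_app (a : A) : B ⬝ a = shift a := rfl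
theorem mul_app (a b c : A) : (a * b) ⬝ c = a ⬝ (b ⬝ c) := ax_B a b c
theorem shift_app (a b : A) : shift a ⬝ b = a * b := rfl
theorem one_app (a : A) : (1 : A) ⬝ a = a := ax_I a

theorem cpow_eq_pow (a : A) (n : ℕ) : cpow a n = a ^ n := by
  induction n with
  | zero => rfl
  | succ n ih => rw [pow_succ', ← ih]; rfl

theorem bullet_app (a b : A) : bullet a ⬝ b = b ⬝ a := by
  simp only [bullet, ax_C, ax_I]

theorem C_one_app (s : Sgn) (a : A) : C s ⬝ 1 ⬝ a = bullet a := C_app_app_eq s Sgn.plus 1 a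

theorem shift_B_mul_C (s : Sgn) : shift B * C s = C s * (shift (C s) * B : A) := ax_bc s

theorem C_mul_C (s : Sgn) : C s * C s.opp = (1 : A) :=
  (ax_cox1 s).trans (by rw [ax_lambda, ax_lambda]; rfl)

theorem C_opp_mul_C (s : Sgn) : C s.opp * C s = (1 : A) := by
  cases s
  · exact C_mul_C Sgn.minus
  · exact C_mul_C Sgn.plus

theorem C_injective (s : Sgn) : Function.Injective (C s ⬝ · : A → A) := fun a b h => by
  have := congrArg (C s.opp ⬝ ·) h
  simpa only [← mul_app, C_opp_mul_C, one_app] using this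

/-- Internalisation of `a ↦ (C g a) ∘ h`. -/
theorem B_mul_C_app (s : Sgn) (g : A) : B * (C s ⬝ g) = C s ⬝ (C s * shift g) := by
  simpa only [mul_app, B_app, shift_app] using congrArg (· ⬝ g) (shift_B_mul_C (A := A) s)

theorem C_app_mul (s : Sgn) (g h a : A) : (C s ⬝ g ⬝ a) * h = C s ⬝ (g * h) ⬝ a := by
  have := congrArg (fun x => x ⬝ a ⬝ h) (B_mul_C_app s g)
  simpa only [mul_app, B_app, shift_app, ax_C] using this

/-- Flipping is precomposition with a global element. -/
theorem C_app_app (s : Sgn) (h a : A) : C s ⬝ h ⬝ a = bullet a * h := by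
  have := C_app_mul s 1 h a
  rw [one_mul, C_one_app] at this
  exact this.symm

theorem C_app_mul_left (s : Sgn) (g h : A) : C s ⬝ (g * h) = bullet h * B * (C s ⬝ g) := by
  have h1 : C s * shift g = C s.opp ⬝ (B * (C s ⬝ g)) := by
    rw [B_mul_C_app, ← mul_app, C_opp_mul_C, one_app]
  have h2 := congrArg (· ⬝ h) h1
  simp only [mul_app, shift_app, C_app_app] at h2
  rw [h2, mul_assoc]

theorem C_app_eq (s : Sgn) (h : A) : C s ⬝ h = bullet h * B * (C s ⬝ 1) := by
  simpa only [one_mul] using C_app_mul_left s 1 h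

theorem C_one_mul (s : Sgn) (f : A) : (C s ⬝ 1) * f = C s ⬝ (bullet f * B) := by
  have h : C s.opp ⬝ ((C s ⬝ 1) * f) = bullet f * B := by
    rw [C_app_mul_left, ← mul_app, C_opp_mul_C, one_app, mul_one]
  rw [← h, ← mul_app, C_mul_C, one_app]

theorem bullet_app_eq (f x : A) : bullet (f ⬝ x) = bullet x * bullet f * B := by
  have h := congrArg (· ⬝ x) (C_one_mul Sgn.plus f)
  simp only [mul_app, C_app_app, mul_one] at h
  rw [h, mul_assoc]

theorem bullet_mul (a b : A) : bullet (a * b) = bullet b * bullet a * bullet B * B * B := by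
  rw [← shift_app, ← B_app, bullet_app_eq, bullet_app_eq]
  simp only [mul_assoc]

theorem bullet_shift (a : A) : bullet (shift a) = bullet a * bullet B * B := by
  rw [← B_app, bullet_app_eq]

theorem bullet_one_mul_B : bullet 1 * B = (1 : A) := by
  rw [← C_app_app Sgn.plus]
  exact (ax_rho _).trans ax_lambda

theorem bullet_mul_C (s : Sgn) (a : A) : bullet a * C s = shift (bullet a) := by
  have h := congrArg (· ⬝ a) (B_mul_C_app s (1 : A))
  simp only [map_one, mul_one, mul_app, C_app_app, B_app] at h
  exact h.symm

/-- `f` acts on `m` strands and returns `n` strands. -/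
def HasArity (m n : ℕ) (f : A) : Prop := bullet f * B ^ (m + 1) = shift f * B ^ n

theorem pow_B_app (n : ℕ) (k : A) : B ^ n ⬝ k = shift^[n] k := by
  induction n with
  | zero => exact one_app k
  | succ n ih => rw [pow_succ', mul_app, ih, Function.iterate_succ_apply', B_app]

theorem HasArity.natural {m n : ℕ} {f : A} (h : HasArity m n f) (k : A) :
    shift^[m] k * f = f * shift^[n] k := by
  have := congrArg (· ⬝ k) h
  simpa only [mul_app, pow_B_app, Function.iterate_succ_apply', bullet_app, shift_app] using this

theorem hasArity_C (s : Sgn) : HasArity 2 2 (C s : A) := by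
  have h := ax_cox2 (A := A) s s
  simp only [comp_eq_mul, C_app_app, B_app, mul_assoc] at h
  simpa only [HasArity, pow_succ, pow_zero, one_mul, mul_assoc] using h

theorem hasArity_B : HasArity 2 1 (B : A) := by
  have h := ax_alpha (A := A) Sgn.plus
  simp only [comp_eq_mul, C_app_app, B_app, mul_assoc] at h
  simpa only [HasArity, pow_succ, pow_zero, one_mul, mul_assoc] using h

theorem C_app_shift (s : Sgn) (k : A) : C s ⬝ shift k = shift k * (C s ⬝ 1) := by
  have h := congrArg (· ⬝ 1) ((hasArity_C s).natural k)
  simp only [Function.iterate_succ_apply', Function.iterate_zero, id, mul_app, shift_app,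
    mul_one] at h
  exact h.symm

theorem mul_bullet (k a : A) : k * bullet a = bullet a * shift k := by
  have h := congrArg (· ⬝ a) (C_app_shift Sgn.plus k)
  simpa only [mul_app, C_app_app, C_one_app, shift_app, mul_one] using h.symm

theorem bullet_B_mul : bullet (B : A) * (B * (B * B)) = shift B * B := by
  simpa only [HasArity, pow_succ, pow_zero, one_mul, mul_assoc] using hasArity_B (A := A)

theorem B_mul_shift (k : A) : B * shift k = shift (shift k) * B := by
  simpa using (hasArity_B.natural k).symm

theorem HasArity.mul {m n p : ℕ} {f g : A} (hf : HasArity m n f) (hg : HasArity n p g) :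
    HasArity m p (f * g) := by
  unfold HasArity at *
  calc bullet (f * g) * B ^ (m + 1)
      = bullet g * bullet f * (bullet B * (B * (B * B))) * B ^ m := by
        rw [bullet_mul, pow_succ']; simp only [mul_assoc]
    _ = bullet g * (bullet f * shift B) * B ^ (m + 1) := by
        rw [bullet_B_mul, pow_succ']; simp only [mul_assoc]
    _ = bullet g * B * (bullet f * B ^ (m + 1)) := by
        rw [← mul_bullet]; simp only [mul_assoc]
    _ = bullet g * (B * shift f) * B ^ n := by rw [hf]; simp only [mul_assoc]
    _ = bullet g * shift (shift f) * (B * B ^ n) := by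
        rw [B_mul_shift]; simp only [mul_assoc]
    _ = shift f * (bullet g * B ^ (n + 1)) := by
        rw [← mul_bullet, pow_succ']; simp only [mul_assoc]
    _ = shift (f * g) * B ^ p := by rw [hg, map_mul, mul_assoc]

theorem HasArity.succ {m n : ℕ} {f : A} (hf : HasArity m n f) : HasArity (m + 1) (n + 1) f := by
  unfold HasArity at *
  rw [pow_succ, ← mul_assoc, hf, mul_assoc, ← pow_succ]

theorem HasArity.tensor_left {m n : ℕ} {f : A} (hf : HasArity m n f) :
    HasArity (m + 1) (n + 1) (shift f) := by
  unfold HasArity at *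
  calc bullet (shift f) * B ^ (m + 1 + 1)
      = bullet f * (bullet B * (B * (B * B))) * B ^ m := by
        rw [bullet_shift, pow_succ', pow_succ']; simp only [mul_assoc]
    _ = bullet f * shift B * B ^ (m + 1) := by
        rw [bullet_B_mul, pow_succ']; simp only [mul_assoc]
    _ = B * (bullet f * B ^ (m + 1)) := by rw [← mul_bullet]; simp only [mul_assoc]
    _ = B * shift f * B ^ n := by rw [hf, mul_assoc]
    _ = shift (shift f) * B ^ (n + 1) := by rw [B_mul_shift, pow_succ', mul_assoc]

theorem hasArity_bullet (a : A) : HasArity 0 1 (bullet a) := by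
  have h2 : bullet (C Sgn.plus : A) * (B * (B * B)) = shift (C Sgn.plus) * (B * B) := by
    simpa only [HasArity, pow_succ, pow_zero, one_mul, mul_assoc] using hasArity_C (A := A) Sgn.plus
  have h := bullet_app_eq (C Sgn.plus ⬝ 1) a
  rw [C_one_app, bullet_app_eq] at h
  unfold HasArity
  calc bullet (bullet a) * B ^ (0 + 1)
      = bullet a * bullet 1 * (bullet (C Sgn.plus) * (B * (B * B))) := by
        rw [h, zero_add, pow_one]; simp only [mul_assoc]
    _ = bullet a * (bullet 1 * shift (C Sgn.plus)) * (B * B) := by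
        rw [h2]; simp only [mul_assoc]
    _ = bullet a * C Sgn.plus * (bullet 1 * B) * B := by
        rw [← mul_bullet]; simp only [mul_assoc]
    _ = shift (bullet a) * B ^ 1 := by
        rw [bullet_one_mul_B, bullet_mul_C, mul_one, pow_one]

/-- The braiding of one strand with `n` strands. -/
def cross (s : Sgn) : ℕ → A
  | 0 => 1
  | n + 1 => C s * shift (cross s n)

theorem C_app_cross (s : Sgn) (n : ℕ) : C s ⬝ (cross s n : A) = B ^ n * (C s ⬝ (1 : A)) := by
  induction n with
  | zero => rw [cross, pow_zero, one_mul]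
  | succ n ih =>
    calc C s ⬝ (C s * shift (cross s n) : A)
        = bullet (cross s n) * bullet B * B * B * (B * (C s ⬝ 1)) := by
          rw [C_app_mul_left, bullet_shift, B_mul_C_app s 1, map_one, mul_one]
      _ = bullet (cross s n) * (bullet B * (B * (B * B))) * (C s ⬝ 1) := by
          simp only [mul_assoc]
      _ = B * (bullet (cross s n) * B * (C s ⬝ 1)) := by
          rw [bullet_B_mul]
          simp only [← mul_assoc]
          rw [← mul_bullet]
      _ = B ^ (n + 1) * (C s ⬝ 1) := by rw [← C_app_eq, ih, pow_succ', mul_assoc]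

/-- The braiding is natural with respect to every element that has an arity. -/
theorem HasArity.shift_mul_cross {m n : ℕ} {f : A} (hf : HasArity m n f) (s : Sgn) :
    shift f * cross s n = cross s m * f := by
  apply C_injective s
  unfold HasArity at hf
  calc C s ⬝ (shift f * cross s n)
      = bullet (cross s n) * (B * shift f) * (C s ⬝ 1) := by
        rw [C_app_mul_left, C_app_shift]; simp only [mul_assoc]
    _ = shift f * (bullet (cross s n) * B * (C s ⬝ 1)) := by
        rw [B_mul_shift, ← mul_assoc, ← mul_bullet]; simp only [mul_assoc]
    _ = bullet f * B ^ (m + 1) * (C s ⬝ 1) := by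
        rw [← C_app_eq, C_app_cross, hf, mul_assoc]
    _ = bullet f * B * (C s ⬝ cross s m) := by
        rw [C_app_cross, pow_succ']; simp only [mul_assoc]
    _ = C s ⬝ (cross s m * f) := by rw [C_app_mul_left]

end Monoid

section Braiding

variable {A : Type*} [ExtBCpmIAlgebra A]

theorem opp_opp (s : Sgn) : s.opp.opp = s := by cases s <;> rfl

theorem shift_C_mul_C (s : Sgn) : shift (C s) * shift (C s.opp) = (1 : A) := by
  rw [← map_mul, C_mul_C, map_one]

theorem shift_C_opp_mul_C (s : Sgn) : shift (C s.opp) * shift (C s) = (1 : A) := by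
  rw [← map_mul, C_opp_mul_C, map_one]

theorem yang_baxter (s : Sgn) : shift (C s) * C s * shift (C s) = C s * shift (C s) *
    (C s : A) := by
  simpa only [comp_eq_mul, B_app, mul_assoc] using ax_cox3 (A := A) s

/-- Variants of the Yang–Baxter equation with an inverse crossing. -/
theorem yang_baxter_opp_left (s : Sgn) :
    shift (C s.opp) * C s * shift (C s) = C s * shift (C s) * (C s.opp : A) := by
  have h1 := yang_baxter (A := A) s
  have h2 := C_mul_C (A := A) s
  have h3 := shift_C_opp_mul_C (A := A) s
  calc (shift (C s.opp) * C s * shift (C s) : A)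
      = shift (C s.opp) * (C s * shift (C s) * C s) * C s.opp := by
        simp only [mul_assoc, h2, mul_one]
    _ = shift (C s.opp) * shift (C s) * C s * shift (C s) * C s.opp := by
        rw [← h1]; simp only [mul_assoc]
    _ = C s * shift (C s) * C s.opp := by rw [h3, one_mul]

theorem yang_baxter_opp_right (s : Sgn) :
    shift (C s) * C s * shift (C s.opp) = C s.opp * shift (C s) * (C s : A) := by
  have h1 := yang_baxter (A := A) s
  have h2 := C_opp_mul_C (A := A) s
  have h3 := shift_C_mul_C (A := A) s
  calc (shift (C s) * C s * shift (C s.opp) : A)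
      = C s.opp * C s * shift (C s) * C s * shift (C s.opp) := by rw [h2, one_mul]
    _ = C s.opp * (C s * shift (C s) * C s) * shift (C s.opp) := by simp only [mul_assoc]
    _ = C s.opp * shift (C s) * C s := by rw [← h1]; simp only [mul_assoc, h3, mul_one]

theorem yang_baxter_opp_left' (s : Sgn) :
    shift (C s) * C s.opp * shift (C s.opp) = C s.opp * shift (C s.opp) * (C s : A) := by
  simpa only [opp_opp] using yang_baxter_opp_left (A := A) s.opp

theorem yang_baxter_opp_right' (s : Sgn) :
    shift (C s.opp) * C s.opp * shift (C s) = C s * shift (C s.opp) * (C s.opp : A) := by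
  simpa only [opp_opp] using yang_baxter_opp_right (A := A) s.opp

theorem reassoc {a b : A} (h : a = b) (x : A) : a * x = b * x := by rw [h]

theorem eq_of_forall_mul {a b : A} (h : ∀ x, a * x = b * x) : a = b := by
  simpa only [mul_one] using h 1

variable {f : A}

namespace HasArity

theorem natural₀₁ (hf : HasArity 0 1 f) (k : A) : k * f = f * shift k := hf.natural k
theorem natural₀₂ (hf : HasArity 0 2 f) (k : A) : k * f = f * shift (shift k) := hf.natural k
theorem natural₁₁ (hf : HasArity 1 1 f) (k : A) : shift k * f = f * shift k := hf.natural k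
theorem natural₁₂ (hf : HasArity 1 2 f) (k : A) : shift k * f = f * shift (shift k) := hf.natural k
theorem natural₂₁ (hf : HasArity 2 1 f) (k : A) : shift (shift k) * f = f * shift k := hf.natural k
theorem natural₂₂ (hf : HasArity 2 2 f) (k : A) :
    shift (shift k) * f = f * shift (shift k) := hf.natural k
theorem natural₂₀ (hf : HasArity 2 0 f) (k : A) : shift (shift k) * f = f * k := hf.natural k

theorem cross₀₂ (hf : HasArity 0 2 f) (s : Sgn) : shift f * C s * shift (C s) = f := by
  simpa [cross, mul_assoc] using hf.shift_mul_cross s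
theorem cross₀₁ (hf : HasArity 0 1 f) (s : Sgn) : shift f * C s = f := by
  simpa [cross, mul_assoc] using hf.shift_mul_cross s
theorem cross₁₁ (hf : HasArity 1 1 f) (s : Sgn) : shift f * C s = C s * f := by
  simpa [cross, mul_assoc] using hf.shift_mul_cross s
theorem cross₁₂ (hf : HasArity 1 2 f) (s : Sgn) : shift f * C s * shift (C s) = C s * f := by
  simpa [cross, mul_assoc] using hf.shift_mul_cross s
theorem cross₂₁ (hf : HasArity 2 1 f) (s : Sgn) : shift f * C s = C s * shift (C s) * f := by
  simpa [cross, mul_assoc] using hf.shift_mul_cross s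
theorem cross₂₀ (hf : HasArity 2 0 f) (s : Sgn) : shift f = C s * shift (C s) * f := by
  simpa [cross, mul_assoc] using hf.shift_mul_cross s

theorem cross_left₀₁ (hf : HasArity 0 1 f) (s : Sgn) : f * C s = shift f := by
  have h := C_opp_mul_C (A := A) s
  nth_rw 1 [← hf.cross₀₁ s.opp]
  rw [mul_assoc, h, mul_one]

theorem cross_left₀₂ (hf : HasArity 0 2 f) (s : Sgn) : f * shift (C s) * C s = shift f := by
  have h1 := C_opp_mul_C (A := A) s
  have h2 := shift_C_opp_mul_C (A := A) s
  nth_rw 1 [← hf.cross₀₂ s.opp]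
  rw [mul_assoc, mul_assoc, ← mul_assoc _ _ (C s), h2, one_mul, mul_assoc,
    h1, mul_one]

theorem cross_left₁₁ (hf : HasArity 1 1 f) (s : Sgn) : f * C s = C s * shift f := by
  have h1 := hf.cross₁₁ s.opp
  have h2 := C_mul_C (A := A) s
  have h3 := C_opp_mul_C (A := A) s
  calc f * C s = C s * (C s.opp * f) * C s := by grind
    _ = C s * shift f * (C s.opp * C s) := by rw [← h1]; simp only [mul_assoc]
    _ = C s * shift f := by grind

theorem cross_left₁₂ (hf : HasArity 1 2 f) (s : Sgn) :
    f * shift (C s) * C s = C s * shift f := by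
  have h1 := hf.cross₁₂ s.opp
  have h2 := C_mul_C (A := A) s
  have h3 := C_opp_mul_C (A := A) s
  have h4 := shift_C_opp_mul_C (A := A) s
  calc f * shift (C s) * C s = C s * (C s.opp * f) * shift (C s) * C s := by grind
    _ = C s * shift f * C s.opp * (shift (C s.opp) * shift (C s)) * C s := by
      rw [← h1]; simp only [mul_assoc]
    _ = C s * shift f := by grind

theorem cross_left₂₁ (hf : HasArity 2 1 f) (s : Sgn) :
    f * C s = shift (C s) * C s * shift f := by
  have h1 := hf.cross₂₁ s.opp
  have h2 := C_mul_C (A := A) s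
  have h3 := C_opp_mul_C (A := A) s
  have h4 := shift_C_mul_C (A := A) s
  calc f * C s = shift (C s) * C s * (C s.opp * shift (C s.opp) * f) * C s := by grind
    _ = shift (C s) * C s * shift f * (C s.opp * C s) := by rw [← h1]; simp only [mul_assoc]
    _ = shift (C s) * C s * shift f := by grind

/-- A cap can be moved across a crossing. -/
theorem slide₂₀ (hf : HasArity 2 0 f) (s : Sgn) : C s.opp * shift f = shift (C s) * f := by
  rw [hf.cross₂₀ s, ← mul_assoc, ← mul_assoc, C_opp_mul_C, one_mul]

theorem slide₂₀' (hf : HasArity 2 0 f) (s : Sgn) : C s * shift f = shift (C s.opp) * f := by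
  simpa only [opp_opp] using hf.slide₂₀ s.opp

/-- A cup can be moved across a crossing. -/
theorem slide₀₂ (hf : HasArity 0 2 f) (s : Sgn) : shift f * C s = f * shift (C s.opp) := by
  have h1 := hf.cross₀₂ s
  have h2 := shift_C_mul_C (A := A) s
  grind

theorem slide₀₂' (hf : HasArity 0 2 f) (s : Sgn) : shift f * C s.opp = f * shift (C s) := by
  simpa only [opp_opp] using hf.slide₀₂ s.opp

end HasArity

/-- An element of arity `0 → 1` is a global element. -/
theorem HasArity.eq_bullet (hf : HasArity 0 1 f) : f = bullet (f ⬝ 1) := by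
  have h : bullet f * B = shift f * B := by simpa only [HasArity, zero_add, pow_one] using hf
  rw [bullet_app_eq, mul_assoc, h, ← mul_assoc, ← mul_bullet, mul_assoc, bullet_one_mul_B, mul_one]

theorem HasArity.eq_bullet_one (hf : HasArity 0 1 f) (h : f * B = 1) : f = bullet 1 := by
  have h := congrArg (· ⬝ 1) h
  simp only [mul_app, B_app, map_one, one_app] at h
  rw [hf.eq_bullet, h]

end Braiding

section Twist

variable {A : Type*} [BalancedExtBCpmIAlgebra A]

theorem hasArity_θ (s : Sgn) : HasArity 1 1 (θ s : A) := by
  have h := ax_theta1 (A := A) s Sgn.plus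
  simp only [comp_eq_mul, C_app_app, B_app] at h
  simpa only [HasArity, pow_succ, pow_zero, one_mul, mul_assoc] using h.symm

theorem θ_mul_θ (s : Sgn) : θ s * θ s.opp = (1 : A) := (ax_theta2 s).trans ax_lambda

theorem θ_opp_mul_θ (s : Sgn) : θ s.opp * θ s = (1 : A) := by
  cases s
  · exact θ_mul_θ Sgn.minus
  · exact θ_mul_θ Sgn.plus

theorem bullet_mul_θ (s : Sgn) (a : A) : bullet a * θ s = bullet a := by
  have h := ax_theta3 Sgn.plus s Sgn.plus a
  rwa [C_app_app, C_app_app, I_eq_one, mul_one] at h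

theorem B_mul_θ (s : Sgn) : (B * θ s : A) = θ s * C s * θ s * C s * B := by
  simpa only [comp_eq_mul, mul_assoc] using ax_theta4 (A := A) s

/-- The twist on three strands, followed by the multiplication of the strands. -/
theorem B_mul_B_mul_θ (s : Sgn) : (B * B * θ s : A) =
    θ s * C s * shift (C s) * shift (C s) * C s *
      shift (θ s * C s * θ s * C s) * B * B := by
  have r1 := reassoc (B_mul_θ (A := A) s)
  have r2 := reassoc ((hasArity_B (A := A)).cross_left₂₁ s)
  have r3 := reassoc ((hasArity_θ (A := A) s).natural₁₁ (B))
  have r4 := reassoc ((hasArity_B (A := A)).cross₂₁ s)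
  have r5 := reassoc ((hasArity_θ (A := A) s).cross_left₁₁ s)
  have r6 := reassoc ((hasArity_θ (A := A) s).natural₁₁ (C s))
  have r7 := reassoc (yang_baxter (A := A) s)
  simp only [mul_assoc] at r1 r2 r3 r4 r5 r6 r7
  refine eq_of_forall_mul fun x => ?_
  simp only [mul_assoc, map_mul]
  calc _ = θ s * (C s * (θ s * (C s * (B * (C s * (θ s * (C s * (B * x)))))))) := by rw [r1, r1]
    _ = θ s * (C s * (θ s * (C s * (shift (C s) * (C s * (θ s * (C s * (shift (C s) * (B * (B *
        x)))))))))) := by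
      rw [r2, r3, r4]
    _ = θ s * (C s * (θ s * (C s * (shift (C s) * (C s * (C s * (shift (θ s) * (shift (C s) * (B *
        (B * x)))))))))) := by
      rw [r5 (shift (C s) * (B * (B * x)))]
    _ = _ := by symm; rw [← r5, r6, r7, r6, r7]

theorem shift_twist_mul_B_mul_B (s : Sgn) :
    shift (θ s) * shift (C s) * shift (θ s) * shift (C s) * B * B =
      C s.opp * shift (C s.opp) * shift (C s.opp) * C s.opp * θ s.opp * B * B * (θ s : A) := by
  have r1 := reassoc (θ_opp_mul_θ (A := A) s)
  have r2 := reassoc (C_opp_mul_C (A := A) s)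
  have r3 := reassoc (congrArg shift (C_opp_mul_C (A := A) s))
  have r4 := reassoc (B_mul_B_mul_θ (A := A) s)
  simp only [mul_assoc, map_mul, map_one, one_mul] at r1 r2 r3 r4
  refine eq_of_forall_mul fun x => ?_
  simp only [mul_assoc]
  calc _ = θ s.opp * (θ s * (shift (θ s) * (shift (C s) * (shift (θ s) * (shift (C s) * (B * (B *
          x))))))) := by
        symm; rw [r1]
    _ = C s.opp * (C s * (θ s.opp * (θ s * (shift (θ s) * (shift (C s) * (shift (θ s) *
        (shift (C s) * (B * (B * x))))))))) := by
      symm; rw [r2]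
    _ = C s.opp * (shift (C s.opp) * (shift (C s) * (C s * (θ s.opp * (θ s * (shift (θ s) *
        (shift (C s) * (shift (θ s) * (shift (C s) * (B * (B * x))))))))))) := by
      symm; rw [r3]
    _ = C s.opp * (shift (C s.opp) * (shift (C s.opp) * (shift (C s) * (shift (C s) * (C s *
        (θ s.opp * (θ s * (shift (θ s) * (shift (C s) * (shift (θ s) * (shift (C s) * (B * (B *
        x))))))))))))) := by
      symm; rw [r3]
    _ = C s.opp * (shift (C s.opp) * (shift (C s.opp) * (C s.opp * (C s * (shift (C s) *
        (shift (C s) * (C s * (θ s.opp * (θ s * (shift (θ s) * (shift (C s) * (shift (θ s) *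
        (shift (C s) * (B * (B * x))))))))))))))) := by
      symm; rw [r2]
    _ = C s.opp * (shift (C s.opp) * (shift (C s.opp) * (C s.opp * (C s * (shift (C s) *
        (shift (C s) * (C s * (shift (θ s) * (shift (C s) * (shift (θ s) * (shift (C s) * (B *
        (B * x))))))))))))) := by
      rw [r1]
    _ = C s.opp * (shift (C s.opp) * (shift (C s.opp) * (C s.opp * (θ s.opp * (θ s * (C s *
        (shift (C s) * (shift (C s) * (C s * (shift (θ s) * (shift (C s) * (shift (θ s) *
        (shift (C s) * (B * (B * x))))))))))))))) := by
      symm; rw [r1]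
    _ = _ := by rw [← r4]

theorem eq_of_shift_mul_B_mul_B {a b : A} (h : shift a * B * B = shift b * B * B) : a = b := by
  have h := congrArg (· ⬝ 1) h
  simpa only [mul_app, B_app, map_one, shift_app, mul_one] using h

/-- The twist is natural. -/
theorem HasArity.twist₁₂ {g : A} (hg : HasArity 1 2 g) (s : Sgn) :
    θ s * g = g * θ s * C s * θ s * C s := by
  have hb : bullet g * B * B = shift g * B * B := by
    simpa only [HasArity, pow_succ, pow_zero, one_mul, mul_assoc] using hg
  have h1 := shift_twist_mul_B_mul_B (A := A) s
  refine (eq_of_shift_mul_B_mul_B ?_).symm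
  simp only [map_mul]
  have r1 := reassoc h1
  have r2 := reassoc (hg.cross₁₂ (s.opp))
  have r3 := reassoc (hg.cross_left₁₂ (s.opp))
  have r4 := reassoc ((hasArity_θ (A := A) s.opp).natural₁₁ (g))
  have r5 := reassoc hb
  have r6 := reassoc (B_mul_B_mul_θ (A := A) s)
  have r7 := reassoc (bullet_mul_θ s g)
  have r8 := reassoc ((hasArity_bullet g).cross_left₀₁ s)
  have r9 := reassoc ((hasArity_bullet g).cross₀₁ s)
  have r10 := reassoc (congrArg shift ((hasArity_bullet g).cross₀₁ s))
  have r11 := reassoc (congrArg shift ((hasArity_bullet g).cross_left₀₁ s))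
  have r12 := reassoc ((hasArity_bullet g).natural₀₁ (θ s))
  have r13 := reassoc (congrArg shift ((hasArity_θ (A := A) s).cross₁₁ s))
  have r14 := reassoc ((hasArity_bullet g).natural₀₁ (C s))
  have r15 := reassoc ((hasArity_bullet g).natural₀₁ (shift (θ s)))
  have r16 := reassoc (θ_opp_mul_θ (A := A) s)
  have r17 := reassoc ((hasArity_θ (A := A) s).cross₁₁ s)
  have r18 := reassoc (C_opp_mul_C (A := A) s)
  have r19 := reassoc ((hasArity_θ (A := A) s).cross_left₁₁ s)
  simp only [mul_assoc, map_mul,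
      one_mul] at r1 r2 r3 r4 r5 r6 r7 r8 r9 r10 r11 r12 r13 r14 r15 r16 r17 r18 r19
  refine eq_of_forall_mul fun x => ?_
  simp only [mul_assoc]
  calc _ = shift g * (C s.opp * (shift (C s.opp) * (shift (C s.opp) * (C s.opp * (θ s.opp * (B *
          (B * (θ s * x)))))))) := by
        rw [r1]
    _ = C s.opp * (g * (shift (C s.opp) * (C s.opp * (θ s.opp * (B * (B * (θ s * x))))))) := by
      rw [r2]
    _ = C s.opp * (C s.opp * (shift g * (θ s.opp * (B * (B * (θ s * x)))))) := by rw [r3]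
    _ = C s.opp * (C s.opp * (θ s.opp * (shift g * (B * (B * (θ s * x)))))) := by rw [r4]
    _ = C s.opp * (C s.opp * (θ s.opp * (bullet g * (B * (B * (θ s * x)))))) := by rw [← r5]
    _ = C s.opp * (C s.opp * (θ s.opp * (bullet g * (θ s * (C s * (shift (C s) * (shift (C s) *
        (C s * (shift (θ s) * (shift (C s) * (shift (θ s) * (shift (C s) * (B * (B *
        x)))))))))))))) := by
      rw [r6]
    _ = C s.opp * (C s.opp * (θ s.opp * (shift (bullet g) * (shift (C s) * (shift (C s) * (C s *
        (shift (θ s) * (shift (C s) * (shift (θ s) * (shift (C s) * (B * (B * x)))))))))))) := by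
      rw [r7, r8]
    _ = C s.opp * (C s.opp * (θ s.opp * (bullet g * (shift (θ s) * (shift (C s) * (shift (θ s) *
        (shift (C s) * (B * (B * x))))))))) := by
      symm; rw [← r9, ← r10, ← r11]
    _ = C s.opp * (C s.opp * (θ s.opp * (θ s * (bullet g * (shift (shift (θ s)) * (shift (C s) *
        (shift (C s) * (B * (B * x))))))))) := by
      rw [← r12, ← r13]
    _ = C s.opp * (C s.opp * (θ s.opp * (θ s * (shift (θ s) * (C s * (C s * (bullet g * (B * (B *
        x))))))))) := by
      symm; rw [r14, r14, r15]
    _ = shift (θ s) * (bullet g * (B * (B * x))) := by rw [r16, r17, r18, r19, r18]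
    _ = _ := by rw [r5]

theorem HasArity.twist₀₂ {g : A} (hg : HasArity 0 2 g) (s : Sgn) :
    g * θ s * C s * θ s * C s = g := by
  have hb : bullet g * B = shift g * B * B := by
    simpa only [HasArity, pow_succ, pow_zero, one_mul, mul_assoc] using hg
  have h1 := shift_twist_mul_B_mul_B (A := A) s
  refine eq_of_shift_mul_B_mul_B ?_
  simp only [map_mul]
  have r1 := reassoc h1
  have r2 := reassoc (hg.cross₀₂ (s.opp))
  have r3 := reassoc (hg.cross_left₀₂ (s.opp))
  have r4 := reassoc ((hasArity_θ (A := A) s.opp).natural₁₁ (g))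
  have r5 := reassoc hb
  have r6 := reassoc (B_mul_θ (A := A) s)
  have r7 := reassoc ((hasArity_bullet g).natural₀₁ (θ s.opp))
  have r8 := reassoc ((hasArity_θ (A := A) s).natural₁₁ (θ s.opp))
  have r9 := reassoc ((hasArity_θ (A := A) s).cross₁₁ s)
  have r10 := reassoc (congrArg shift (θ_opp_mul_θ (A := A) s))
  have r11 := reassoc ((hasArity_bullet g).cross₀₁ s)
  have r12 := reassoc ((hasArity_bullet g).cross_left₀₁ s)
  have r13 := reassoc (bullet_mul_θ s g)
  simp only [mul_assoc, map_mul, map_one, one_mul] at r1 r2 r3 r4 r5 r6 r7 r8 r9 r10 r11 r12 r13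
  refine eq_of_forall_mul fun x => ?_
  simp only [mul_assoc]
  calc _ = shift g * (C s.opp * (shift (C s.opp) * (shift (C s.opp) * (C s.opp * (θ s.opp * (B *
          (B * (θ s * x)))))))) := by
        rw [r1]
    _ = g * (shift (C s.opp) * (C s.opp * (θ s.opp * (B * (B * (θ s * x)))))) := by rw [r2]
    _ = shift g * (θ s.opp * (B * (B * (θ s * x)))) := by rw [r3]
    _ = θ s.opp * (shift g * (B * (B * (θ s * x)))) := by rw [r4]
    _ = θ s.opp * (bullet g * (B * (θ s * x))) := by rw [← r5]
    _ = θ s.opp * (bullet g * (θ s * (C s * (θ s * (C s * (B * x)))))) := by rw [r6]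
    _ = bullet g * (θ s * (C s * (C s * (B * x)))) := by rw [r7, r8, ← r9, r10]
    _ = bullet g * (B * x) := by symm; rw [← r11, ← r12, ← r13]
    _ = _ := by rw [r5]

/-- Composition of elements as an operation on two strands. -/
def compMap {A : Type*} [BCpmISignature A] : A := bullet B ⊚ B ⊚ B

theorem compMap_eq : (compMap : A) = bullet B * B * B := by
  simp only [compMap, comp_eq_mul, mul_assoc]

theorem hasArity_compMap : HasArity 2 1 (compMap : A) := by
  rw [compMap_eq]
  exact ((hasArity_bullet (B : A)).succ.succ.mul hasArity_B.succ).mul hasArity_B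

theorem shift_B_mul_B : shift B * B = (compMap * B : A) := by
  have := bullet_B_mul (A := A)
  simp only [compMap_eq, mul_assoc, this]

theorem compMap_mul_θ (s : Sgn) : compMap * θ s = θ s * C s * θ s * C s * (compMap : A) := by
  rw [compMap_eq]
  have r1 := reassoc (B_mul_B_mul_θ (A := A) s)
  have r2 := reassoc (bullet_mul_θ s (B : A))
  have r3 := reassoc ((hasArity_bullet (B : A)).cross_left₀₁ s)
  have r4 := reassoc (congrArg shift ((hasArity_bullet (B : A)).cross_left₀₁ s))
  have r5 := reassoc (congrArg shift ((hasArity_bullet (B : A)).cross₀₁ s))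
  have r6 := reassoc ((hasArity_bullet (B : A)).cross₀₁ s)
  have r7 := reassoc ((hasArity_bullet (B : A)).natural₀₁ (C s))
  have r8 := reassoc ((hasArity_bullet (B : A)).natural₀₁ (θ s))
  simp only [mul_assoc, map_mul] at r1 r2 r3 r4 r5 r6 r7 r8
  refine eq_of_forall_mul fun x => ?_
  simp only [mul_assoc]
  calc _ = bullet B * (θ s * (C s * (shift (C s) * (shift (C s) * (C s * (shift (θ s) *
          (shift (C s) * (shift (θ s) * (shift (C s) * (B * (B * x))))))))))) := by
        rw [r1]
    _ = bullet B * (C s * (shift (C s) * (shift (C s) * (C s * (shift (θ s) * (shift (C s) *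
        (shift (θ s) * (shift (C s) * (B * (B * x)))))))))) := by
      rw [r2]
    _ = bullet B * (shift (θ s) * (shift (C s) * (shift (θ s) * (shift (C s) * (B * (B *
        x)))))) := by
      rw [r3, r4, r5, r6]
    _ = _ := by symm; rw [r7, r8, r7, r8]

end Twist

theorem hasArity_one {A : Type*} [ExtBCpmIAlgebra A] : HasArity 0 0 (1 : A) := by
  rw [HasArity, zero_add, pow_one, bullet_one_mul_B, map_one, pow_zero, mul_one]

theorem shift_bullet_one_mul_compMap {A : Type*} [BalancedExtBCpmIAlgebra A] :
    shift (bullet 1) * compMap = (1 : A) := by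
  have h1 : C Sgn.plus ⬝ B ⬝ 1 = (1 : A) := by rw [C_app_app, bullet_one_mul_B]
  have h2 := congrArg bullet h1
  rw [bullet_app_eq, bullet_app_eq] at h2
  have h3 : bullet (C Sgn.plus : A) * (B * (B * B)) = shift (C Sgn.plus) * (B * B) := by
    simpa only [HasArity, pow_succ, pow_zero, one_mul, mul_assoc] using hasArity_C (A := A) Sgn.plus
  calc shift (bullet 1) * (compMap : A) = bullet 1 * (C Sgn.plus * bullet B) * (B * B) := by
        rw [← bullet_mul_C Sgn.plus, compMap_eq]; simp only [mul_assoc]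
    _ = bullet 1 * bullet B * (shift (C Sgn.plus) * (B * B)) := by
        rw [mul_bullet]; simp only [mul_assoc]
    _ = bullet 1 * (bullet B * bullet (C Sgn.plus) * B) * B * B := by
        rw [← h3]; simp only [mul_assoc]
    _ = 1 := by rw [h2, bullet_one_mul_B]

namespace IsTraceCombinator

variable {A : Type*} [BalancedExtBCpmIAlgebra A] {Tr : A} (hT : IsTraceCombinator Tr)
include hT

theorem hasArity : HasArity 1 2 Tr := by
  have h := hT.left_tightening Sgn.plus
  simp only [comp_eq_mul, C_app_app, B_app, cpow_eq_pow] at h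
  simpa only [HasArity, pow_succ, pow_zero, one_mul, mul_assoc] using h

theorem B_mul : B * Tr = shift Tr * compMap := by
  have h := hT.right_tightening Sgn.plus
  simp only [comp_eq_mul, C_app_app, B_app] at h
  rw [← h, compMap_eq]

theorem shift_mul_app (k f : A) : Tr ⬝ (shift k * f) = k * (Tr ⬝ f) := by
  have h := congrArg (· ⬝ f) (hT.hasArity.natural₁₂ k)
  simpa only [mul_app, shift_app] using h.symm

theorem shift_app_eq (f : A) : shift (Tr ⬝ f) = Tr * shift f * B := by
  have h := congrArg (· ⬝ f) hT.B_mul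
  simp only [compMap_eq, mul_app, B_app, bullet_app, shift_app] at h
  rw [h, mul_assoc]

theorem mul_shift_app (f k : A) : Tr ⬝ (f * shift k) = (Tr ⬝ f) * k := by
  have h := congrArg (· ⬝ k) (hT.shift_app_eq f)
  simpa only [mul_app, B_app, shift_app] using h.symm

theorem shift_mul_mul_shift_app (k f l : A) :
    Tr ⬝ (shift k * f * shift l) = k * (Tr ⬝ f) * l := by
  rw [hT.mul_shift_app, hT.shift_mul_app]

theorem app_C (s : Sgn) : Tr ⬝ C s = θ s := hT.yanking s

theorem app_app_conj (s : Sgn) (f : A) : Tr ⬝ (Tr ⬝ (C s * f * C s.opp)) = Tr ⬝ (Tr ⬝ f) := by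
  have h (f : A) : Tr ⬝ (Tr ⬝ (C Sgn.plus * f * C Sgn.minus)) = Tr ⬝ (Tr ⬝ f) := by
    have h := congrArg (· ⬝ f) (hT.exchange Sgn.plus)
    simpa only [comp_eq_mul, C_app_app, cpow_eq_pow, pow_two, mul_app, B_app, shift_app,
      bullet_app] using h
  cases s
  · exact h f
  · rw [← h]
    have h1 := C_mul_C (A := A) Sgn.plus
    simp only [Sgn.opp] at h1 ⊢
    simp only [mul_assoc, h1, mul_one]
    rw [← mul_assoc, h1, one_mul]

theorem app_app_app_conj (s : Sgn) (f : A) :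
    Tr ⬝ (Tr ⬝ (Tr ⬝ (C s * shift (C s) * f * shift (C s.opp) * C s.opp))) =
      Tr ⬝ (Tr ⬝ (Tr ⬝ f)) := by
  have h := hT.app_app_conj s (shift (C s) * f * shift (C s.opp))
  simp only [← mul_assoc] at h
  rw [h, hT.mul_shift_app, hT.shift_mul_app, hT.app_app_conj]

theorem hasArity_app {m n : ℕ} {f : A} (hf : HasArity (m + 1) (n + 1) f) :
    HasArity m n (Tr ⬝ f) := by
  have h : bullet Tr * (B * B) = shift Tr * (B * B) := by
    simpa only [HasArity, pow_succ, pow_zero, one_mul, mul_assoc] using hT.hasArity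
  unfold HasArity at *
  calc bullet (Tr ⬝ f) * B ^ (m + 1) = bullet f * (bullet Tr * (B * B)) * B ^ m := by
        rw [bullet_app_eq, pow_succ']; simp only [mul_assoc]
    _ = bullet f * shift Tr * B ^ (m + 1 + 1) := by
        rw [h, pow_succ', pow_succ']; simp only [mul_assoc]
    _ = Tr * (bullet f * B ^ (m + 1 + 1)) := by rw [← mul_bullet]; simp only [mul_assoc]
    _ = Tr * shift f * B * B ^ n := by rw [hf, pow_succ']; simp only [mul_assoc]
    _ = shift (Tr ⬝ f) * B ^ n := by rw [hT.shift_app_eq]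

/-- Sliding an element around the loop of a trace. -/
theorem app_slide₁₁ {g : A} (hg : HasArity 1 1 g) (s : Sgn) (f : A) :
    Tr ⬝ (f * θ s * g) = Tr ⬝ (g * θ s * f) := by
  have e1 : shift f * g * C s = (shift f * C s * shift g : A) := by
    have r1 := reassoc (hg.cross_left₁₁ s)
    simp only [mul_assoc] at r1
    refine eq_of_forall_mul fun x => ?_
    simp only [mul_assoc]
    rw [r1]
  have e2 : C s * shift f * g * C s * C s.opp = (shift g * C s * shift f : A) := by
    have r1 := reassoc (C_mul_C (A := A) s)
    have r2 := reassoc (hg.cross₁₁ s)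
    have r3 := reassoc (hg.natural₁₁ (f))
    simp only [mul_assoc, one_mul] at r1 r2 r3
    refine eq_of_forall_mul fun x => ?_
    simp only [mul_assoc]
    calc _ = C s * (shift f * (g * x)) := by rw [r1]
      _ = _ := by symm; rw [r2, ← r3]
  calc Tr ⬝ (f * θ s * g) = Tr ⬝ (Tr ⬝ (shift f * g * C s)) := by
        rw [e1, hT.mul_shift_app, hT.shift_mul_app, hT.app_C]
    _ = Tr ⬝ (Tr ⬝ (C s * shift f * g * C s * C s.opp)) := by
        rw [← hT.app_app_conj s]; simp only [mul_assoc]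
    _ = Tr ⬝ (g * θ s * f) := by rw [e2, hT.mul_shift_app, hT.shift_mul_app, hT.app_C]

theorem app_mul_θ (s : Sgn) (f : A) : Tr ⬝ (f * θ s) = Tr ⬝ (θ s * f) := by
  simpa only [mul_one, one_mul] using hT.app_slide₁₁ hasArity_one.succ s f

theorem app_slide₁₂ {g : A} (hg : HasArity 1 2 g) (f : A) :
    Tr ⬝ (Tr ⬝ (f * g)) = Tr ⬝ (g * f) := by
  suffices h : ∀ (s : Sgn) (f : A), Tr ⬝ (Tr ⬝ (f * θ s.opp * g)) = Tr ⬝ (θ s.opp * g * f) by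
    have h := h Sgn.plus (f * θ Sgn.plus)
    have h1 := θ_mul_θ (A := A) Sgn.plus
    rwa [mul_assoc f, h1, mul_one, ← mul_assoc, hT.app_mul_θ, ← mul_assoc, ← mul_assoc, h1,
      one_mul] at h
  intro s f
  have e1 : shift f * g * shift (C s.opp) * C s.opp = (shift f * C s.opp * shift g : A) := by
    have r1 := reassoc (hg.cross_left₁₂ (s.opp))
    simp only [mul_assoc] at r1
    refine eq_of_forall_mul fun x => ?_
    simp only [mul_assoc]
    rw [r1]
  have e2 : C s * shift (C s) * shift (C s.opp) * C s.opp * shift f * g * shift (C s.opp) *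
      C s.opp = (shift f * g * shift (C s.opp) * C s.opp : A) := by
    have r1 := reassoc (congrArg shift (C_mul_C (A := A) s))
    have r2 := reassoc (C_mul_C (A := A) s)
    simp only [mul_assoc, map_mul, map_one, one_mul] at r1 r2
    refine eq_of_forall_mul fun x => ?_
    simp only [mul_assoc]
    rw [r1, r2]
  have e3 : shift (C s.opp) * C s.opp * shift f * g = (shift (shift g) * shift (C s.opp) *
      shift (shift (C s.opp)) * C s.opp * shift (C s.opp) * shift (shift f) : A) := by
    have r1 := reassoc (hg.natural₁₂ (f))
    have r2 := reassoc (hg.cross₁₂ (s.opp))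
    have r3 := reassoc (congrArg shift (hg.cross₁₂ (s.opp)))
    simp only [mul_assoc, map_mul] at r1 r2 r3
    refine eq_of_forall_mul fun x => ?_
    simp only [mul_assoc]
    rw [r1, ← r2, ← r3]
  have e4 : C s.opp * shift (C s.opp) * θ s.opp * C s.opp = (shift (θ s.opp) * shift (C s.opp) *
      C s.opp * shift (C s.opp) : A) := by
    have r1 := reassoc ((hasArity_θ (A := A) s.opp).natural₁₁ (C s.opp))
    have r2 := reassoc ((hasArity_θ (A := A) s.opp).cross₁₁ (s.opp))
    have r3 := reassoc (yang_baxter (A := A) (s.opp))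
    simp only [mul_assoc] at r1 r2 r3
    refine eq_of_forall_mul fun x => ?_
    simp only [mul_assoc]
    calc _ = shift (θ s.opp) * (C s.opp * (shift (C s.opp) * (C s.opp * x))) := by rw [r1, ← r2]
      _ = _ := by symm; rw [r3]
  have e5 : g * θ s.opp * C s.opp * θ s.opp * C s.opp * f = (θ s.opp * g * f : A) := by
    have r1 := reassoc (hg.twist₁₂ s.opp)
    simp only [mul_assoc] at r1
    refine eq_of_forall_mul fun x => ?_
    simp only [mul_assoc]
    rw [← r1]
  calc Tr ⬝ (Tr ⬝ (f * θ s.opp * g))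
      = Tr ⬝ (Tr ⬝ (Tr ⬝ (shift f * g * shift (C s.opp) * C s.opp))) := by
        rw [e1, hT.mul_shift_app, hT.shift_mul_app, hT.app_C]
    _ = Tr ⬝ (Tr ⬝ (Tr ⬝ (shift (C s.opp) * C s.opp * shift f * g))) := by
        rw [← hT.app_app_app_conj s (shift (C s.opp) * C s.opp * shift f * g), ← e2]
        simp only [mul_assoc]
    _ = Tr ⬝ (Tr ⬝ (Tr ⬝ (shift (shift g) * (shift (C s.opp * shift (C s.opp)) *
          (C s.opp * shift (C s.opp))) * shift (shift f)))) := by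
        rw [e3]; simp only [map_mul, mul_assoc]
    _ = Tr ⬝ (Tr ⬝ (shift g * (C s.opp * shift (C s.opp) * θ s.opp * C s.opp) * shift f)) := by
        rw [hT.shift_mul_mul_shift_app, hT.shift_mul_app, hT.mul_shift_app (C s.opp), hT.app_C]
        simp only [mul_assoc]
    _ = Tr ⬝ (g * (Tr ⬝ (shift (θ s.opp) * (shift (C s.opp) * (C s.opp * shift (C s.opp))))) *
          f) := by
        rw [hT.shift_mul_mul_shift_app, e4]; simp only [mul_assoc]
    _ = Tr ⬝ (g * θ s.opp * C s.opp * θ s.opp * C s.opp * f) := by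
        simp only [mul_assoc, hT.shift_mul_app, hT.mul_shift_app, hT.app_C]
    _ = Tr ⬝ (θ s.opp * g * f) := by rw [e5]

theorem app_slide₂₁ {g : A} (hg : HasArity 2 1 g) (s : Sgn) (f : A) :
    Tr ⬝ (g * θ s * f) = Tr ⬝ (C s * shift f * C s * θ s * g) := by
  have e1 : C s.opp * shift g * C s * shift f * C s = (shift (C s) * shift (shift f) *
      shift (C s) * C s * shift g : A) := by
    have r1 := reassoc (hg.cross₂₁ s)
    have r2 := reassoc (C_opp_mul_C (A := A) s)
    have r3 := reassoc (hg.cross_left₂₁ s)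
    have r4 := reassoc (hg.natural₂₁ (f))
    simp only [mul_assoc, one_mul] at r1 r2 r3 r4
    refine eq_of_forall_mul fun x => ?_
    simp only [mul_assoc]
    calc _ = shift (C s) * (g * (shift f * (C s * x))) := by rw [r1, r2]
      _ = _ := by symm; rw [← r3, r4]
  calc Tr ⬝ (g * θ s * f) = Tr ⬝ (Tr ⬝ (shift g * C s * shift f)) := by
        rw [hT.mul_shift_app, hT.shift_mul_app, hT.app_C]
    _ = Tr ⬝ (Tr ⬝ (C s.opp * shift g * C s * shift f * C s)) := by
        rw [← hT.app_app_conj s.opp]; simp only [mul_assoc, opp_opp]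
    _ = Tr ⬝ (C s * shift f * C s * θ s * g) := by
        rw [e1, hT.mul_shift_app]
        simp only [mul_assoc, hT.shift_mul_app, hT.app_C]

end IsTraceCombinator

/-- The counit of the duality obtained from a trace combinator, for either choice of crossing. -/
def traceCounit {A : Type*} [BalancedExtBCpmIAlgebra A] (Tr : A) (s : Sgn) : A :=
  Tr ⬝ (C s * shift (C s) * shift B * B)

/-- The unit of the duality obtained from a trace combinator, for either choice of crossing. -/
def traceUnit {A : Type*} [BalancedExtBCpmIAlgebra A] (Tr : A) (s : Sgn) : A :=
  Tr ⬝ (Tr * shift Tr * shift (C s) * C s)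

namespace IsTraceCombinator

variable {A : Type*} [BalancedExtBCpmIAlgebra A] {Tr : A} (hT : IsTraceCombinator Tr)
include hT

theorem hasArity_traceCounit (s : Sgn) : HasArity 2 0 (traceCounit Tr s) :=
  hT.hasArity_app ((((hasArity_C s).succ.mul (hasArity_C s).tensor_left).mul
    hasArity_B.tensor_left).mul hasArity_B)

theorem hasArity_traceUnit (s : Sgn) : HasArity 0 2 (traceUnit Tr s) :=
  hT.hasArity_app (((hT.hasArity.mul hT.hasArity.tensor_left).mul
    (hasArity_C s).tensor_left).mul (hasArity_C s).succ)

theorem C_mul_traceCounit (s : Sgn) :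
    C s * traceCounit Tr s = θ s.opp * traceCounit Tr s := by
  have e1 : shift (C s) * C s * shift (C s) * shift B * B = (C s * B * θ s * θ s.opp * C s *
      B : A) := by
    have r1 := reassoc (yang_baxter (A := A) s)
    have r2 := reassoc ((hasArity_B (A := A)).cross_left₂₁ s)
    have r3 := reassoc (θ_mul_θ (A := A) s)
    simp only [mul_assoc, one_mul] at r1 r2 r3
    refine eq_of_forall_mul fun x => ?_
    simp only [mul_assoc]
    calc _ = C s * (B * (C s * (B * x))) := by rw [r1, ← r2]
      _ = _ := by symm; rw [r3]
  have e2 : C s * shift (θ s.opp) * shift (C s) * shift B * C s * θ s * C s * B = (θ s.opp * C s *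
      shift (C s) * C s * shift (C s) * B * θ s * C s * B : A) := by
    have r1 := reassoc ((hasArity_θ (A := A) s.opp).cross_left₁₁ s)
    have r2 := reassoc ((hasArity_B (A := A)).cross₂₁ s)
    simp only [mul_assoc] at r1 r2
    refine eq_of_forall_mul fun x => ?_
    simp only [mul_assoc]
    calc _ = θ s.opp * (C s * (shift (C s) * (shift B * (C s * (θ s * (C s * (B * x))))))) := by
          rw [← r1]
      _ = _ := by symm; rw [← r2]
  have e3 : C s * shift (C s) * C s * shift (C s) * B * θ s * C s * B * θ s.opp =
      (shift (θ s.opp) * C s * shift (C s) * shift B * B : A) := by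
    have r1 := reassoc (B_mul_θ (A := A) s.opp)
    have r2 := reassoc ((hasArity_θ (A := A) s.opp).cross₁₁ s)
    have r3 := reassoc (C_mul_C (A := A) s)
    have r4 := reassoc ((hasArity_θ (A := A) s).natural₁₁ (θ s.opp))
    have r5 := reassoc (θ_mul_θ (A := A) s)
    have r6 := reassoc ((hasArity_θ (A := A) s.opp).cross₁₁ (s.opp))
    have r7 := reassoc ((hasArity_B (A := A)).cross₂₁ s)
    have r8 := reassoc ((hasArity_θ (A := A) s.opp).natural₁₁ (C s))
    have r9 := reassoc ((hasArity_θ (A := A) s.opp).natural₁₁ (B))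
    simp only [mul_assoc, one_mul] at r1 r2 r3 r4 r5 r6 r7 r8 r9
    refine eq_of_forall_mul fun x => ?_
    simp only [mul_assoc]
    calc _ = C s * (shift (C s) * (C s * (shift (C s) * (B * (θ s * (C s * (θ s.opp * (C s.opp *
            (θ s.opp * (C s.opp * (B * x))))))))))) := by
          rw [r1]
      _ = C s * (shift (C s) * (C s * (shift (C s) * (B * (shift (θ s.opp) * (C s.opp * (B *
          x))))))) := by
        rw [← r2, r3, ← r4, r5]
      _ = C s * (shift (C s) * (C s * (shift (C s) * (B * (C s.opp * (θ s.opp * (B * x))))))) := by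
        symm; rw [← r6]
      _ = C s * (shift (C s) * (shift B * (θ s.opp * (B * x)))) := by rw [← r7, r3]
      _ = _ := by symm; rw [r2, ← r8, ← r9]
  calc C s * traceCounit Tr s
      = Tr ⬝ (C s * B * θ s * (θ s.opp * C s * B)) := by
        rw [traceCounit, ← hT.shift_mul_app]; simp only [← mul_assoc]; rw [e1]
    _ = Tr ⬝ (θ s.opp * (C s * shift (C s) * C s * shift (C s) * B * θ s * C s * B)) := by
        rw [hT.app_slide₂₁ ((hasArity_C s).mul hasArity_B)]
        simp only [map_mul, ← mul_assoc]
        rw [e2]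
    _ = Tr ⬝ (shift (θ s.opp) * (C s * shift (C s) * shift B * B)) := by
        rw [← hT.app_mul_θ, e3]; simp only [mul_assoc]
    _ = θ s.opp * traceCounit Tr s := by rw [hT.shift_mul_app, traceCounit]

theorem traceCounit_eq (s : Sgn) : traceCounit Tr s = compMap * (Tr ⬝ (C s * B)) := by
  have e : C s * shift (C s) * shift B * B = (shift compMap * C s * B : A) := by
    have r1 := reassoc (shift_B_mul_B (A := A))
    have r2 := reassoc ((hasArity_compMap (A := A)).cross₂₁ s)
    simp only [mul_assoc] at r1 r2
    refine eq_of_forall_mul fun x => ?_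
    simp only [mul_assoc]
    rw [r1, ← r2]
  rw [traceCounit, e, mul_assoc, hT.shift_mul_app]

theorem app_C_mul_B (s : Sgn) : Tr ⬝ (C s * B) = θ s.opp * (Tr ⬝ (C s.opp * B)) := by
  have e1 : C s * B = (shift (θ s.opp) * θ s.opp * C s.opp * B * θ s : A) := by
    have r1 := reassoc (θ_opp_mul_θ (A := A) s)
    have r2 := reassoc (B_mul_θ (A := A) s.opp)
    have r3 := reassoc ((hasArity_θ (A := A) s.opp).cross₁₁ s)
    have r4 := reassoc (C_mul_C (A := A) s)
    simp only [mul_assoc, one_mul] at r1 r2 r3 r4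
    refine eq_of_forall_mul fun x => ?_
    simp only [mul_assoc]
    calc _ = C s * (B * (θ s.opp * (θ s * x))) := by symm; rw [r1]
      _ = C s * (θ s.opp * (C s.opp * (θ s.opp * (C s.opp * (B * (θ s * x)))))) := by rw [r2]
      _ = _ := by rw [← r3, r4]
  have e2 : θ s * shift (θ s.opp) * θ s.opp * C s.opp * B = (shift (θ s.opp) * C s.opp *
      B : A) := by
    have r1 := reassoc ((hasArity_θ (A := A) s).natural₁₁ (θ s.opp))
    have r2 := reassoc (θ_mul_θ (A := A) s)
    simp only [mul_assoc, one_mul] at r1 r2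
    refine eq_of_forall_mul fun x => ?_
    simp only [mul_assoc]
    rw [← r1, r2]
  rw [e1, hT.app_mul_θ]
  simp only [← mul_assoc]
  rw [e2, mul_assoc, hT.shift_mul_app]

theorem traceCounit_opp (s : Sgn) : traceCounit Tr s.opp = traceCounit Tr s := by
  have h1 := compMap_mul_θ (A := A) s
  have h2 := θ_mul_θ (A := A) s
  have h3 := hT.C_mul_traceCounit s
  have h4 : Tr ⬝ (C s.opp * B) = θ s * (Tr ⬝ (C s * B)) := by
    rw [hT.app_C_mul_B s, ← mul_assoc, h2, one_mul]
  calc traceCounit Tr s.opp = compMap * θ s * (Tr ⬝ (C s * B)) := by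
        rw [hT.traceCounit_eq, h4, mul_assoc]
    _ = θ s * C s * θ s * (C s * traceCounit Tr s) := by
        rw [h1, hT.traceCounit_eq]; simp only [mul_assoc]
    _ = θ s * C s * (θ s * θ s.opp) * traceCounit Tr s := by rw [h3]; simp only [mul_assoc]
    _ = θ s * (C s * traceCounit Tr s) := by rw [h2]; simp only [mul_assoc, one_mul]
    _ = traceCounit Tr s := by rw [h3, ← mul_assoc, h2, one_mul]

theorem C_opp_mul_traceCounit (s : Sgn) :
    C s.opp * traceCounit Tr s = θ s * traceCounit Tr s := by
  have h := hT.C_mul_traceCounit s.opp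
  rwa [hT.traceCounit_opp, opp_opp] at h

theorem shift_θ_mul_traceCounit (s : Sgn) :
    shift (θ s) * traceCounit Tr s = θ s * traceCounit Tr s := by
  have r1 := reassoc (θ_mul_θ (A := A) s)
  have r2 := reassoc ((hasArity_θ (A := A) s).natural₁₁ (θ s))
  have r3 := reassoc (hT.C_mul_traceCounit s)
  have r4 := reassoc ((hasArity_θ (A := A) s).cross₁₁ s)
  have r5 := reassoc (hT.C_opp_mul_traceCounit s)
  have r6 := reassoc (C_mul_C (A := A) s)
  simp only [mul_assoc, one_mul] at r1 r2 r3 r4 r5 r6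
  refine eq_of_forall_mul fun x => ?_
  simp only [mul_assoc]
  calc _ = shift (θ s) * (θ s * (θ s.opp * (traceCounit Tr s * x))) := by symm; rw [r1]
    _ = θ s * (shift (θ s) * (θ s.opp * (traceCounit Tr s * x))) := by rw [r2]
    _ = θ s * (shift (θ s) * (C s * (traceCounit Tr s * x))) := by rw [← r3]
    _ = θ s * (C s * (θ s * (traceCounit Tr s * x))) := by rw [r4]
    _ = θ s * (C s * (C s.opp * (traceCounit Tr s * x))) := by rw [← r5]
    _ = _ := by rw [r6]

theorem app_mul_C (s : Sgn) : Tr ⬝ (Tr * C s) = bullet 1 := by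
  have e1 : Tr * C s * shift B = (Tr * shift (C s.opp) * B * C s : A) := by
    have r1 := reassoc ((hasArity_B (A := A)).cross_left₂₁ s)
    have r2 := reassoc (congrArg shift (C_opp_mul_C (A := A) s))
    simp only [mul_assoc, map_mul, map_one, one_mul] at r1 r2
    refine eq_of_forall_mul fun x => ?_
    simp only [mul_assoc]
    symm; rw [r1, r2]
  have e2 : Tr * shift (C s.opp) * B = shift (θ s.opp) := by
    rw [← hT.shift_app_eq, hT.app_C]
  refine (hT.hasArity_app (hT.hasArity.mul (hasArity_C s))).eq_bullet_one ?_
  rw [← hT.mul_shift_app, e1, e2, hT.shift_mul_app, hT.app_C, θ_opp_mul_θ]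

theorem mul_shift_C_opp_mul_traceCounit (s : Sgn) :
    Tr * shift (C s.opp) * traceCounit Tr s = C s.opp * θ s.opp * B := by
  have e1 : Tr * shift (C s.opp) * B = shift (θ s.opp) := by
    rw [← hT.shift_app_eq, hT.app_C]
  have e2 : shift Tr * shift (shift (C s.opp)) * C s * shift (C s) * shift B * B = (C s *
      shift (C s) * shift B * shift (θ s.opp) : A) := by
    have r1 := reassoc ((hasArity_C (A := A) s).natural₂₂ (C s.opp))
    have r2 := reassoc ((hT.hasArity).natural₁₂ (C s))
    have r3 := reassoc (congrArg shift (yang_baxter_opp_left' (A := A) s))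
    have r4 := reassoc ((hT.hasArity).cross₁₂ s)
    have r5 := reassoc (congrArg shift (C_mul_C (A := A) s))
    have r6 := reassoc (congrArg shift ((hasArity_B (A := A)).cross₂₁ (s.opp)))
    have r7 := reassoc ((hT.hasArity).natural₁₂ (B))
    have r8 := reassoc e1
    simp only [mul_assoc, map_mul, map_one, one_mul] at r1 r2 r3 r4 r5 r6 r7 r8
    refine eq_of_forall_mul fun x => ?_
    simp only [mul_assoc]
    calc _ = shift Tr * (C s * (shift (shift (C s.opp)) * (shift (C s) * (shift B * (B *
            x))))) := by
          rw [r1]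
      _ = C s * (shift (C s) * (Tr * (shift (C s.opp) * (shift (shift (C s.opp)) * (shift B * (B *
          x)))))) := by
        symm; rw [r2, r3, ← r4, r5]
      _ = C s * (shift (C s) * (Tr * (shift (shift B) * (shift (C s.opp) * (B * x))))) := by
        rw [← r6]
      _ = C s * (shift (C s) * (shift B * (Tr * (shift (C s.opp) * (B * x))))) := by rw [← r7]
      _ = _ := by rw [r8]
  have e3 : θ s * C s * B * θ s.opp = (C s.opp * θ s.opp * B : A) := by
    have r1 := reassoc (B_mul_θ (A := A) s.opp)
    have r2 := reassoc ((hasArity_θ (A := A) s.opp).cross₁₁ s)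
    have r3 := reassoc (C_mul_C (A := A) s)
    have r4 := reassoc ((hasArity_θ (A := A) s).natural₁₁ (θ s.opp))
    have r5 := reassoc (θ_mul_θ (A := A) s)
    have r6 := reassoc ((hasArity_θ (A := A) s.opp).cross₁₁ (s.opp))
    simp only [mul_assoc, one_mul] at r1 r2 r3 r4 r5 r6
    refine eq_of_forall_mul fun x => ?_
    simp only [mul_assoc]
    calc _ = θ s * (C s * (θ s.opp * (C s.opp * (θ s.opp * (C s.opp * (B * x)))))) := by rw [r1]
      _ = shift (θ s.opp) * (C s.opp * (B * x)) := by rw [← r2, r3, ← r4, r5]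
      _ = _ := by symm; rw [← r6]
  calc Tr * shift (C s.opp) * traceCounit Tr s
      = Tr ⬝ (C s * shift (C s * B * θ s.opp)) := by
        rw [traceCounit, ← hT.shift_mul_app]
        simp only [map_mul, ← mul_assoc]
        rw [e2]
    _ = C s.opp * θ s.opp * B := by
        rw [hT.mul_shift_app, hT.app_C, ← e3]; simp only [mul_assoc]

theorem traceUnit_mul_shift_traceCounit (s : Sgn) :
    traceUnit Tr s * shift (traceCounit Tr s) = 1 := by
  have e1 : Tr * shift Tr * shift (C s) * C s * shift (shift (traceCounit Tr s)) = (Tr *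
      shift (C s.opp) * shift (θ s.opp) * shift B * C s : A) := by
    have r1 := reassoc ((hasArity_C (A := A) s).natural₂₂ (traceCounit Tr s))
    have r2 := reassoc (congrArg shift ((hT.hasArity_traceCounit s).slide₂₀' s))
    have r3 := reassoc (congrArg shift (hT.mul_shift_C_opp_mul_traceCounit s))
    simp only [mul_assoc, map_mul] at r1 r2 r3
    refine eq_of_forall_mul fun x => ?_
    simp only [mul_assoc]
    calc _ = Tr * (shift Tr * (shift (C s) * (shift (shift (traceCounit Tr s)) * (C s * x)))) := by
          rw [← r1]
      _ = Tr * (shift Tr * (shift (shift (C s.opp)) * (shift (traceCounit Tr s) * (C s * x)))) := by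
        rw [r2]
      _ = _ := by rw [r3]
  have e2 : shift (C s.opp) * shift (θ s.opp) * shift B * C s * Tr = (shift (C s.opp) *
      shift (θ s.opp) * shift B * shift Tr * C s * shift (C s) : A) := by
    have r1 := reassoc ((hT.hasArity).cross₁₂ s)
    simp only [mul_assoc] at r1
    refine eq_of_forall_mul fun x => ?_
    simp only [mul_assoc]
    rw [← r1]
  have e3 : C s.opp * θ s.opp * B * Tr * θ s * C s = (shift (θ s.opp) * Tr * C s *
      shift (C s.opp) * shift compMap * shift (θ s) : A) := by
    have r1 := reassoc hT.B_mul
    have r2 := reassoc ((hasArity_θ (A := A) s.opp).cross₁₁ (s.opp))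
    have r3 := reassoc ((hT.hasArity).cross_left₁₂ (s.opp))
    have r4 := reassoc (compMap_mul_θ (A := A) s)
    have r5 := reassoc ((hasArity_θ (A := A) s).cross_left₁₁ s)
    have r6 := reassoc ((hasArity_compMap (A := A)).cross_left₂₁ s)
    have r7 := reassoc (yang_baxter_opp_right (A := A) s)
    have r8 := reassoc (congrArg shift (C_opp_mul_C (A := A) s))
    simp only [mul_assoc, map_mul, map_one, one_mul] at r1 r2 r3 r4 r5 r6 r7 r8
    refine eq_of_forall_mul fun x => ?_
    simp only [mul_assoc]
    calc _ = C s.opp * (θ s.opp * (shift Tr * (compMap * (θ s * (C s * x))))) := by rw [r1]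
      _ = shift (θ s.opp) * (C s.opp * (shift Tr * (compMap * (θ s * (C s * x))))) := by rw [← r2]
      _ = shift (θ s.opp) * (Tr * (shift (C s.opp) * (C s.opp * (compMap * (θ s * (C s *
          x)))))) := by
        rw [← r3]
      _ = shift (θ s.opp) * (Tr * (shift (C s.opp) * (C s.opp * (θ s * (C s * (θ s * (C s *
          (compMap * (C s * x))))))))) := by
        rw [r4]
      _ = shift (θ s.opp) * (Tr * (shift (C s.opp) * (C s.opp * (compMap * (θ s * (C s *
          x)))))) := by
        rw [← r4]
      _ = shift (θ s.opp) * (Tr * (shift (C s.opp) * (C s.opp * (compMap * (C s * (shift (θ s) *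
          x)))))) := by
        rw [r5]
      _ = shift (θ s.opp) * (Tr * (shift (C s.opp) * (C s.opp * (shift (C s) * (C s *
          (shift compMap * (shift (θ s) * x))))))) := by
        rw [r6]
      _ = _ := by rw [← r7, r8]
  have e4 : θ s.opp * bullet 1 * C s.opp * compMap * θ s = (1 : A) := by
    have r1 := reassoc ((hasArity_bullet (1 : A)).cross_left₀₁ (s.opp))
    have r2 := reassoc (shift_bullet_one_mul_compMap (A := A))
    have r3 := reassoc (θ_opp_mul_θ (A := A) s)
    simp only [mul_assoc, one_mul] at r1 r2 r3
    refine eq_of_forall_mul fun x => ?_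
    simp only [mul_assoc, one_mul]
    calc _ = θ s.opp * (shift (bullet 1) * (compMap * (θ s * x))) := by rw [r1]
      _ = _ := by rw [r2, r3]
  calc traceUnit Tr s * shift (traceCounit Tr s)
      = Tr ⬝ (Tr * (shift (C s.opp) * shift (θ s.opp) * shift B * C s)) := by
        rw [traceUnit, ← hT.mul_shift_app, e1]; simp only [mul_assoc]
    _ = Tr ⬝ (Tr ⬝ (shift (C s.opp * θ s.opp * B * Tr) * C s * shift (C s))) := by
        rw [← hT.app_slide₁₂ hT.hasArity, e2]; simp only [map_mul, mul_assoc]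
    _ = Tr ⬝ (shift (θ s.opp) * (Tr * C s) * shift (C s.opp * compMap * θ s)) := by
        rw [hT.shift_mul_mul_shift_app, hT.app_C, e3]; simp only [map_mul, mul_assoc]
    _ = 1 := by
        rw [hT.shift_mul_mul_shift_app, hT.app_mul_C]; simpa only [mul_assoc] using e4

theorem shift_traceUnit_mul_traceCounit (s : Sgn) :
    shift (traceUnit Tr s) * traceCounit Tr s = 1 := by
  have e1 : Tr * shift Tr * shift (C s) * C s * shift (shift (C s.opp)) * shift (C s.opp) *
      shift (traceCounit Tr s) = (Tr * C s * shift (C s.opp) * shift compMap : A) := by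
    have r1 := reassoc ((hasArity_C (A := A) s).natural₂₂ (C s.opp))
    have r2 := reassoc (congrArg shift (hT.C_opp_mul_traceCounit s))
    have r3 := reassoc ((hasArity_θ (A := A) s).cross_left₁₁ s)
    have r4 := reassoc ((hT.hasArity_traceCounit s).slide₂₀' s)
    have r5 := reassoc ((hasArity_θ (A := A) s).natural₁₁ (C s.opp))
    have r6 := reassoc (hT.C_opp_mul_traceCounit s)
    have r7 := reassoc (congrArg shift (yang_baxter_opp_right' (A := A) s))
    have r8 := reassoc ((hasArity_C (A := A) s.opp).natural₂₂ (C s))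
    have r9 := reassoc ((hT.hasArity_traceCounit s).natural₂₀ (C s))
    have r10 := reassoc (congrArg shift ((hT.hasArity).cross_left₁₂ (s.opp)))
    have r11 := reassoc ((hasArity_C (A := A) s.opp).natural₂₂ (Tr))
    have r12 := reassoc ((hT.hasArity_traceCounit s).natural₂₀ (Tr))
    have r13 := reassoc (hT.shift_θ_mul_traceCounit s)
    have r14 := reassoc (congrArg shift ((hasArity_θ (A := A) s).cross₁₁ (s.opp)))
    have r15 := reassoc ((hT.hasArity).natural₁₂ (θ s))
    have r16 := reassoc (hT.mul_shift_C_opp_mul_traceCounit s)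
    have r17 := reassoc ((hasArity_θ (A := A) s).cross₁₁ (s.opp))
    have r18 := reassoc (θ_mul_θ (A := A) s)
    have r19 := reassoc hT.B_mul
    have r20 := reassoc ((hT.hasArity).cross_left₁₂ (s.opp))
    have r21 := reassoc ((hasArity_compMap (A := A)).cross_left₂₁ s)
    have r22 := reassoc (yang_baxter_opp_right (A := A) s)
    have r23 := reassoc (congrArg shift (C_opp_mul_C (A := A) s))
    simp only [mul_assoc, map_mul, map_one,
        one_mul] at r1 r2 r3 r4 r5 r6 r7 r8 r9 r10 r11 r12 r13 r14 r15 r16 r17 r18 r19 r20 r21 r22 r23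
    refine eq_of_forall_mul fun x => ?_
    simp only [mul_assoc]
    calc _ = Tr * (shift Tr * (shift (C s) * (shift (shift (C s.opp)) * (C s * (shift (C s.opp) *
            (shift (traceCounit Tr s) * x)))))) := by
          rw [← r1]
      _ = Tr * (shift Tr * (shift (C s) * (shift (shift (C s.opp)) * (C s * (shift (θ s) *
          (shift (traceCounit Tr s) * x)))))) := by
        rw [r2]
      _ = Tr * (shift Tr * (shift (C s) * (shift (shift (C s.opp)) * (θ s * (C s *
          (shift (traceCounit Tr s) * x)))))) := by
        rw [← r3]
      _ = Tr * (shift Tr * (shift (C s) * (shift (shift (C s.opp)) * (θ s * (shift (C s.opp) *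
          (traceCounit Tr s * x)))))) := by
        rw [r4]
      _ = Tr * (shift Tr * (shift (C s) * (shift (shift (C s.opp)) * (shift (C s.opp) * (θ s *
          (traceCounit Tr s * x)))))) := by
        rw [← r5]
      _ = Tr * (shift Tr * (shift (C s) * (shift (shift (C s.opp)) * (shift (C s.opp) * (C s.opp *
          (traceCounit Tr s * x)))))) := by
        symm; rw [r6]
      _ = Tr * (shift Tr * (shift (shift (C s.opp)) * (shift (C s.opp) * (shift (shift (C s)) *
          (C s.opp * (traceCounit Tr s * x)))))) := by
        rw [← r7]
      _ = Tr * (shift Tr * (shift (shift (C s.opp)) * (shift (C s.opp) * (C s.opp *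
          (shift (shift (C s)) * (traceCounit Tr s * x)))))) := by
        rw [r8]
      _ = Tr * (shift Tr * (shift (shift (C s.opp)) * (shift (C s.opp) * (C s.opp *
          (traceCounit Tr s * (C s * x)))))) := by
        symm; rw [← r9]
      _ = Tr * (shift (C s.opp) * (shift (shift Tr) * (C s.opp * (traceCounit Tr s * (C s *
          x))))) := by
        rw [r10]
      _ = Tr * (shift (C s.opp) * (C s.opp * (shift (shift Tr) * (traceCounit Tr s * (C s *
          x))))) := by
        rw [r11]
      _ = Tr * (shift (C s.opp) * (C s.opp * (traceCounit Tr s * (Tr * (C s * x))))) := by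
        symm; rw [← r12]
      _ = Tr * (shift (C s.opp) * (θ s * (traceCounit Tr s * (Tr * (C s * x))))) := by rw [r6]
      _ = Tr * (shift (C s.opp) * (shift (θ s) * (traceCounit Tr s * (Tr * (C s * x))))) := by
        symm; rw [r13]
      _ = Tr * (shift (shift (θ s)) * (shift (C s.opp) * (traceCounit Tr s * (Tr * (C s *
          x))))) := by
        rw [← r14]
      _ = shift (θ s) * (Tr * (shift (C s.opp) * (traceCounit Tr s * (Tr * (C s * x))))) := by
        rw [← r15]
      _ = shift (θ s) * (C s.opp * (θ s.opp * (B * (Tr * (C s * x))))) := by rw [r16]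
      _ = C s.opp * (B * (Tr * (C s * x))) := by rw [r17, r18]
      _ = C s.opp * (shift Tr * (compMap * (C s * x))) := by rw [r19]
      _ = Tr * (shift (C s.opp) * (C s.opp * (compMap * (C s * x)))) := by rw [← r20]
      _ = Tr * (shift (C s.opp) * (C s.opp * (shift (C s) * (C s * (shift compMap * x))))) := by
        rw [r21]
      _ = _ := by rw [← r22, r23]
  have e2 : bullet 1 * C s.opp * compMap = (1 : A) := by
    have r1 := reassoc ((hasArity_bullet (1 : A)).cross_left₀₁ (s.opp))
    have r2 := reassoc (shift_bullet_one_mul_compMap (A := A))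
    simp only [mul_assoc, one_mul] at r1 r2
    refine eq_of_forall_mul fun x => ?_
    simp only [mul_assoc, one_mul]
    rw [r1, r2]
  have e3 : shift (traceUnit Tr s) = traceUnit Tr s * shift (C s.opp) * C s.opp :=
    ((hT.hasArity_traceUnit s).cross_left₀₂ s.opp).symm
  calc shift (traceUnit Tr s) * traceCounit Tr s
      = Tr ⬝ (Tr * shift Tr * shift (C s) * C s *
          shift (shift (C s.opp) * C s.opp * traceCounit Tr s)) := by
        rw [e3, hT.mul_shift_app, traceUnit]; simp only [mul_assoc]
    _ = Tr ⬝ (Tr * C s * shift (C s.opp * compMap)) := by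
        simp only [map_mul, ← mul_assoc]; rw [e1]
    _ = 1 := by
        rw [hT.mul_shift_app, hT.app_mul_C]; simpa only [mul_assoc] using e2

theorem mul_C_eq {X : A} (hX : HasArity 1 2 X) (s : Sgn) :
    X * C s = shift (traceUnit Tr s) * X * shift (C s.opp) * traceCounit Tr s := by
  have r1 := reassoc (congrArg shift (hT.shift_traceUnit_mul_traceCounit s))
  have r2 := reassoc ((hasArity_C (A := A) s).natural₂₂ (traceUnit Tr s))
  have r3 := reassoc (hX.natural₁₂ (traceUnit Tr s))
  have r4 := reassoc ((hT.hasArity_traceCounit s).slide₂₀' s)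
  simp only [mul_assoc, map_mul, map_one, one_mul] at r1 r2 r3 r4
  refine eq_of_forall_mul fun x => ?_
  simp only [mul_assoc]
  calc _ = X * (C s * (shift (shift (traceUnit Tr s)) * (shift (traceCounit Tr s) * x))) := by
        symm; rw [r1]
    _ = X * (shift (shift (traceUnit Tr s)) * (C s * (shift (traceCounit Tr s) * x))) := by
      rw [← r2]
    _ = shift (traceUnit Tr s) * (X * (C s * (shift (traceCounit Tr s) * x))) := by rw [← r3]
    _ = _ := by rw [r4]

/-- A trace combinator is recovered from the duality that it induces. -/
theorem eq_traceOfDuality (s : Sgn) :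
    Tr = bullet (traceCounit Tr s) * B * shift (traceUnit Tr s) * B := by
  have e0 : bullet (traceCounit Tr s) * B * B * B = shift (traceCounit Tr s) := by
    simpa only [HasArity, pow_succ, pow_zero, one_mul, mul_one, mul_assoc]
      using hT.hasArity_traceCounit s
  have e1 : shift (bullet (traceCounit Tr s)) * shift B * shift B * C s * shift (C s) * shift B *
      B = (C s * shift (C s) * shift (shift (C s)) * shift (shift B) *
      shift (traceCounit Tr s) : A) := by
    have r1 := reassoc ((hasArity_B (A := A)).cross₂₁ s)
    have r2 := reassoc ((hasArity_B (A := A)).natural₂₁ (C s))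
    have r3 := reassoc ((hasArity_bullet (traceCounit Tr s)).cross₀₁ s)
    have r4 := reassoc ((hasArity_bullet (traceCounit Tr s)).natural₀₁ (C s))
    have r5 := reassoc ((hasArity_bullet (traceCounit Tr s)).natural₀₁ (shift (shift (C s))))
    have r6 := reassoc ((hasArity_bullet (traceCounit Tr s)).natural₀₁ (shift (C s)))
    have r7 := reassoc ((hasArity_B (A := A)).natural₂₁ (shift (C s)))
    have r8 := reassoc ((hasArity_B (A := A)).natural₂₁ (B))
    have r9 := reassoc ((hasArity_B (A := A)).natural₂₁ (shift B))
    have r10 := reassoc ((hasArity_bullet (traceCounit Tr s)).natural₀₁ (shift (shift B)))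
    have r11 := reassoc e0
    simp only [mul_assoc] at r1 r2 r3 r4 r5 r6 r7 r8 r9 r10 r11
    refine eq_of_forall_mul fun x => ?_
    simp only [mul_assoc]
    calc _ = C s * (bullet (traceCounit Tr s) * (B * (shift (C s) * (shift (shift (C s)) * (B *
            (shift B * (B * x))))))) := by
          rw [r1, ← r2, r1, r3, ← r4]
      _ = C s * (shift (C s) * (shift (shift (C s)) * (bullet (traceCounit Tr s) * (B * (B *
          (shift B * (B * x))))))) := by
        symm; rw [r5, r6, r7, r2]
      _ = C s * (shift (C s) * (shift (shift (C s)) * (bullet (traceCounit Tr s) * (B *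
          (shift (shift B) * (B * (B * x))))))) := by
        rw [← r8]
      _ = C s * (shift (C s) * (shift (shift (C s)) * (bullet (traceCounit Tr s) *
          (shift (shift (shift B)) * (B * (B * (B * x))))))) := by
        symm; rw [r9]
      _ = C s * (shift (C s) * (shift (shift (C s)) * (shift (shift B) *
          (bullet (traceCounit Tr s) * (B * (B * (B * x))))))) := by
        rw [← r10]
      _ = _ := by rw [r11]
  have e2 : bullet (traceCounit Tr s) * B * B * traceCounit Tr s =
      θ s * C s * shift (C s) * shift B * traceCounit Tr s := by
    calc bullet (traceCounit Tr s) * B * B * traceCounit Tr s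
        = Tr ⬝ (shift (bullet (traceCounit Tr s)) * shift B * shift B *
            C s * shift (C s) * shift B * B) := by
          nth_rw 2 [traceCounit]
          rw [← hT.shift_mul_app]
          simp only [map_mul, mul_assoc]
      _ = Tr ⬝ (C s * shift (C s * shift (C s) * shift B * traceCounit Tr s)) := by
          rw [e1]; simp only [map_mul, mul_assoc]
      _ = θ s * C s * shift (C s) * shift B * traceCounit Tr s := by
          rw [hT.mul_shift_app, hT.app_C]; simp only [mul_assoc]
  have e3 : bullet (traceCounit Tr s) * B * shift (traceUnit Tr s) * B * shift (C s.opp) *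
      traceCounit Tr s = (C s.opp * θ s.opp * B : A) := by
    have r1 := reassoc ((hasArity_B (A := A)).natural₂₁ (C s.opp))
    have r2 := reassoc ((hasArity_B (A := A)).natural₂₁ (traceUnit Tr s))
    have r3 := reassoc ((hasArity_B (A := A)).natural₂₁ (shift (C s.opp)))
    have r4 := reassoc ((hasArity_bullet (traceCounit Tr s)).natural₀₁ (shift (shift (C s.opp))))
    have r5 := reassoc ((hasArity_bullet (traceCounit Tr s)).natural₀₁ (shift (traceUnit Tr s)))
    have r6 := reassoc e2
    have r7 := reassoc ((hasArity_θ (A := A) s).natural₁₁ (shift (C s.opp)))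
    have r8 := reassoc ((hasArity_C (A := A) s).natural₂₂ (C s.opp))
    have r9 := reassoc ((hasArity_θ (A := A) s).natural₁₁ (traceUnit Tr s))
    have r10 := reassoc ((hT.hasArity_traceUnit s).slide₀₂ s)
    have r11 := reassoc ((hT.hasArity_traceUnit s).natural₀₂ (B))
    have r12 := reassoc ((hT.hasArity_traceUnit s).natural₀₂ (C s))
    have r13 := reassoc (congrArg shift ((hasArity_B (A := A)).cross₂₁ (s.opp)))
    have r14 := reassoc (congrArg shift (yang_baxter_opp_left' (A := A) s))
    have r15 := reassoc (hT.C_mul_traceCounit s)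
    have r16 := reassoc ((hasArity_θ (A := A) s.opp).natural₁₁ (traceUnit Tr s))
    have r17 := reassoc (hT.shift_traceUnit_mul_traceCounit s)
    have r18 := reassoc (B_mul_θ (A := A) s.opp)
    have r19 := reassoc ((hasArity_θ (A := A) s.opp).cross₁₁ s)
    have r20 := reassoc (C_mul_C (A := A) s)
    have r21 := reassoc ((hasArity_θ (A := A) s).natural₁₁ (θ s.opp))
    have r22 := reassoc (θ_mul_θ (A := A) s)
    have r23 := reassoc ((hasArity_θ (A := A) s.opp).cross₁₁ (s.opp))
    simp only [mul_assoc, map_mul,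
        one_mul] at r1 r2 r3 r4 r5 r6 r7 r8 r9 r10 r11 r12 r13 r14 r15 r16 r17 r18 r19 r20 r21 r22 r23
    refine eq_of_forall_mul fun x => ?_
    simp only [mul_assoc]
    calc _ = bullet (traceCounit Tr s) * (B * (shift (traceUnit Tr s) * (shift (shift (C s.opp)) *
            (B * (traceCounit Tr s * x))))) := by
          rw [← r1]
      _ = bullet (traceCounit Tr s) * (shift (shift (traceUnit Tr s)) *
          (shift (shift (shift (C s.opp))) * (B * (B * (traceCounit Tr s * x))))) := by
        rw [← r2, ← r3]
      _ = shift (traceUnit Tr s) * (shift (shift (C s.opp)) * (bullet (traceCounit Tr s) * (B *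
          (B * (traceCounit Tr s * x))))) := by
        symm; rw [r4, r5]
      _ = shift (traceUnit Tr s) * (shift (shift (C s.opp)) * (θ s * (C s * (shift (C s) *
          (shift B * (traceCounit Tr s * x)))))) := by
        rw [r6]
      _ = θ s * (traceUnit Tr s * (shift (C s.opp) * (shift (shift (C s.opp)) * (shift (C s) *
          (shift B * (traceCounit Tr s * x)))))) := by
        rw [r7, r8, r9, r10]
      _ = θ s * (C s * (B * (traceUnit Tr s * (shift (C s.opp) * (traceCounit Tr s * x))))) := by
        symm; rw [r11, r12, r13, r14]
      _ = θ s * (C s * (B * (shift (traceUnit Tr s) * (C s * (traceCounit Tr s * x))))) := by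
        rw [← r10]
      _ = θ s * (C s * (B * (shift (traceUnit Tr s) * (θ s.opp * (traceCounit Tr s * x))))) := by
        rw [r15]
      _ = θ s * (C s * (B * (θ s.opp * (shift (traceUnit Tr s) * (traceCounit Tr s * x))))) := by
        symm; rw [← r16]
      _ = θ s * (C s * (B * (θ s.opp * x))) := by rw [r17]
      _ = θ s * (C s * (θ s.opp * (C s.opp * (θ s.opp * (C s.opp * (B * x)))))) := by rw [r18]
      _ = shift (θ s.opp) * (C s.opp * (B * x)) := by rw [← r19, r20, ← r21, r22]
      _ = _ := by symm; rw [← r23]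
  have hX : HasArity 1 2 (bullet (traceCounit Tr s) * B * shift (traceUnit Tr s) * B) :=
    ((((hasArity_bullet _).succ.mul hasArity_B).mul
      (hT.hasArity_traceUnit s).tensor_left).mul hasArity_B.succ)
  have e4 : Tr * C s = bullet (traceCounit Tr s) * B * shift (traceUnit Tr s) * B * C s := by
    rw [hT.mul_C_eq hT.hasArity, hT.mul_C_eq hX]
    simp only [mul_assoc] at e3 ⊢
    rw [e3]
    have h := hT.mul_shift_C_opp_mul_traceCounit s
    simp only [mul_assoc] at h
    rw [h]
  have e5 := congrArg (· * C s.opp) e4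
  have h := C_mul_C (A := A) s
  simp only [mul_assoc, h, mul_one] at e5
  simpa only [mul_assoc] using e5

end IsTraceCombinator

namespace IsDuality

variable {A : Type*} {α β : A}

theorem hasArity_unit [ExtBCpmIAlgebra A] (h : IsDuality α β) : HasArity 0 2 α := by
  have := h.arity_α
  rw [cpow_eq_pow] at this
  rwa [HasArity, zero_add, pow_one]

theorem hasArity_counit [ExtBCpmIAlgebra A] (h : IsDuality α β) : HasArity 2 0 β := by
  have := h.arity_β
  rw [cpow_eq_pow] at this
  rwa [HasArity, pow_zero, mul_one]

theorem unit_mul_shift_counit [ExtBCpmIAlgebra A] (h : IsDuality α β) : α * shift β = 1 :=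
  h.duality₁.trans (map_one shift)

theorem shift_unit_mul_counit [ExtBCpmIAlgebra A] (h : IsDuality α β) : shift α * β = 1 :=
  h.duality₂.trans (map_one shift)

theorem mk' [ExtBCpmIAlgebra A] (hα : HasArity 0 2 α) (hβ : HasArity 2 0 β)
    (h₁ : α * shift β = 1) (h₂ : shift α * β = 1) : IsDuality α β where
  arity_α := by rw [HasArity, zero_add, pow_one] at hα; rw [cpow_eq_pow]; exact hα
  arity_β := by rw [HasArity, pow_zero, mul_one] at hβ; rw [cpow_eq_pow]; exact hβ
  duality₁ := h₁.trans (map_one shift).symm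
  duality₂ := h₂.trans (map_one shift).symm

/-- Compatibility of the counit with the twist is inherited by the unit. -/
theorem isRibbonDuality [BalancedExtBCpmIAlgebra A] (h : IsDuality α β)
    (hθ : ∀ s, shift (θ s) * β = θ s * β) : IsRibbonDuality α β := by
  refine ⟨h, fun s => ?_⟩
  have hθ := hθ s
  change α * θ s = α * shift (θ s)
  symm
  have r1 := reassoc (congrArg shift h.shift_unit_mul_counit)
  have r2 := reassoc (congrArg shift ((hasArity_θ (A := A) s).natural₁₁ (α)))
  have r3 := reassoc ((h.hasArity_unit).natural₀₂ (α))
  have r4 := reassoc (congrArg shift hθ)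
  have r5 := reassoc ((h.hasArity_unit).natural₀₂ (θ s))
  have r6 := reassoc h.unit_mul_shift_counit
  simp only [mul_assoc, map_mul, map_one, one_mul] at r1 r2 r3 r4 r5 r6
  refine eq_of_forall_mul fun x => ?_
  simp only [mul_assoc]
  calc _ = α * (shift (θ s) * (shift (shift α) * (shift β * x))) := by symm; rw [r1]
    _ = α * (shift (shift α) * (shift (θ s) * (shift β * x))) := by rw [← r2]
    _ = α * (α * (shift (θ s) * (shift β * x))) := by symm; rw [r3]
    _ = _ := by rw [← r4, ← r5, r6]

end IsDuality

theorem IsTraceCombinator.isRibbonDuality {A : Type*} [BalancedExtBCpmIAlgebra A] {Tr : A}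
    (hT : IsTraceCombinator Tr) :
    IsRibbonDuality (unitOfTrace Tr) (counitOfTrace Tr) ∧
      Tr = traceOfDuality (unitOfTrace Tr) (counitOfTrace Tr) := by
  have hα : unitOfTrace Tr = traceUnit Tr Sgn.plus := by
    simp only [unitOfTrace, traceUnit, comp_eq_mul, B_app, mul_assoc]
  have hβ : counitOfTrace Tr = traceCounit Tr Sgn.plus := by
    simp only [counitOfTrace, traceCounit, comp_eq_mul, B_app, mul_assoc]
  rw [hα, hβ]
  refine ⟨(IsDuality.mk' (hT.hasArity_traceUnit _) (hT.hasArity_traceCounit _)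
    (hT.traceUnit_mul_shift_traceCounit _)
    (hT.shift_traceUnit_mul_traceCounit _)).isRibbonDuality fun s => ?_, ?_⟩
  · cases s
    · exact hT.shift_θ_mul_traceCounit Sgn.plus
    · rw [← hT.traceCounit_opp]
      exact hT.shift_θ_mul_traceCounit Sgn.minus
  · rw [traceOfDuality]
    simp only [comp_eq_mul, B_app, C_app_app, ← mul_assoc]
    exact hT.eq_traceOfDuality Sgn.plus

section Sandwich

variable {A : Type*} [ExtBCpmIAlgebra A]

/-- The element that represents `f ↦ a ∘ f ∘ b`. -/
def sandwich (a b : A) : A := bullet b * B * shift a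

theorem sandwich_mul (a b c d : A) :
    sandwich a b * sandwich c d = sandwich (a * c) (d * b) := by
  have h : bullet (d * b) * B = bullet b * bullet d * (shift B * B) := by
    rw [bullet_mul, ← bullet_B_mul]; simp only [mul_assoc]
  unfold sandwich
  calc bullet b * B * shift a * (bullet d * B * shift c)
      = bullet b * B * (shift a * bullet d) * B * shift c := by simp only [mul_assoc]
    _ = bullet b * (B * bullet d) * (shift (shift a) * B) * shift c := by
        rw [mul_bullet]; simp only [mul_assoc]
    _ = bullet b * bullet d * (shift B * B) * shift a * shift c := by
        rw [mul_bullet, ← B_mul_shift]; simp only [mul_assoc]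
    _ = bullet (d * b) * B * shift (a * c) := by rw [h, map_mul]; simp only [mul_assoc]

theorem B_mul_sandwich (a b : A) : B * sandwich a b = sandwich (shift a) (shift b) * B := by
  unfold sandwich
  calc B * (bullet b * B * shift a) = (B * bullet b) * B * shift a := by simp only [mul_assoc]
    _ = bullet b * (shift B * B) * shift a := by rw [mul_bullet]; simp only [mul_assoc]
    _ = bullet b * bullet B * B * B * (B * shift a) := by
        rw [← bullet_B_mul]; simp only [mul_assoc]
    _ = bullet (shift b) * B * shift (shift a) * B := by
        rw [B_mul_shift, bullet_shift]; simp only [mul_assoc]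

theorem sandwich_C_mul (s : Sgn) :
    sandwich (C s) (C s.opp) * B * B = (B * B : A) := by
  have h1 : bullet (C s : A) * (B * (B * B)) = shift (C s) * (B * B) := by
    simpa only [HasArity, pow_succ, pow_zero, one_mul, mul_assoc] using hasArity_C (A := A) s
  have h2 := bullet_mul (C s : A) (C s.opp)
  rw [C_mul_C] at h2
  unfold sandwich
  calc bullet (C s.opp) * B * shift (C s) * B * (B : A)
      = bullet (C s.opp) * (B * bullet (C s)) * (B * (B * B)) := by
        simp only [mul_assoc, h1]
    _ = bullet (C s.opp) * bullet (C s) * (shift B * B) * (B * B) := by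
        rw [mul_bullet]; simp only [mul_assoc]
    _ = bullet 1 * B * (B * B) := by
        rw [h2, ← bullet_B_mul]; simp only [mul_assoc]
    _ = B * B := by rw [bullet_one_mul_B, one_mul]

theorem traceOfDuality_eq (a b : A) : traceOfDuality a b = sandwich a b * B := by
  simp only [traceOfDuality, sandwich, comp_eq_mul, C_app_app, B_app, mul_assoc]

theorem traceOfDuality_app (a b f : A) : traceOfDuality a b ⬝ f = a * shift f * b := by
  rw [traceOfDuality_eq, sandwich]
  simp only [mul_app, B_app, shift_app, bullet_app]

theorem hasArity_traceOfDuality {a b : A} (ha : HasArity 0 2 a) :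
    HasArity 1 2 (traceOfDuality a b) := by
  rw [traceOfDuality_eq, sandwich]
  exact (((hasArity_bullet _).succ.mul hasArity_B).mul ha.tensor_left).mul hasArity_B.succ

theorem shift_traceOfDuality_mul {a b : A} (hb : HasArity 2 0 b) :
    shift (traceOfDuality a b) * (bullet B * B) * B = B * traceOfDuality a b := by
  have e1 : bullet (bullet b) * B = shift (bullet b) * B := by
    simpa only [HasArity, pow_succ, pow_zero, one_mul] using hasArity_bullet b
  have e2 : bullet B * B * B * B = shift B * (B : A) := by
    simpa only [mul_assoc] using bullet_B_mul (A := A)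
  have e0 : bullet b * (B * (B * B)) = shift b := by
    simpa only [HasArity, pow_succ, pow_zero, one_mul, mul_one, mul_assoc] using hb
  have e3 : bullet (B * (B * B)) * bullet (bullet b) * bullet B * B * B =
      bullet b * bullet B * B := by
    rw [← bullet_mul, e0, bullet_shift]
  have e4 : bullet (B * (B * B)) * B = (bullet B * B * bullet B * B * bullet B * B : A) := by
    have h (a b : A) : bullet (a * b) * B = bullet b * B * bullet a * B := by
      calc bullet (a * b) * B = bullet b * bullet a * (bullet B * B * B * B) := by
            rw [bullet_mul]; simp only [mul_assoc]
        _ = bullet b * (B * bullet a) * B := by rw [e2, mul_bullet B a]; simp only [mul_assoc]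
        _ = bullet b * B * bullet a * B := by simp only [mul_assoc]
    rw [h, h]
  rw [traceOfDuality_eq, sandwich]
  simp only [map_mul, ← mul_assoc]
  symm
  have r1 := reassoc ((hasArity_bullet b).natural₀₁ (B))
  have r2 := reassoc e2
  have r3 := reassoc e3
  have r4 := reassoc e1
  have r5 := reassoc ((hasArity_bullet (bullet b)).natural₀₁ (B))
  have r6 := reassoc ((hasArity_B (A := A)).natural₂₁ (bullet b))
  have r7 := reassoc ((hasArity_bullet (B * (B * B) : A)).natural₀₁ (shift (bullet b)))
  have r8 := reassoc ((hasArity_B (A := A)).natural₂₁ (a))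
  have r9 := reassoc ((hasArity_B (A := A)).natural₂₁ (shift a))
  have r10 := reassoc ((hasArity_bullet (B * (B * B) : A)).natural₀₁ (shift (shift (shift a))))
  have r11 := reassoc ((hasArity_B (A := A)).natural₂₁ (shift (shift a)))
  have r12 := reassoc e4
  have r13 := reassoc ((hasArity_B (A := A)).natural₂₁ (B))
  have r14 := reassoc ((hasArity_bullet (B : A)).natural₀₁ (shift B))
  have r15 := reassoc (congrArg shift ((hasArity_B (A := A)).natural₂₁ (a)))
  simp only [mul_assoc, map_mul] at r1 r2 r3 r4 r5 r6 r7 r8 r9 r10 r11 r12 r13 r14 r15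
  refine eq_of_forall_mul fun x => ?_
  simp only [mul_assoc]
  calc _ = bullet b * (shift B * (B * (shift a * (B * x)))) := by rw [r1]
    _ = bullet b * (bullet B * (B * (B * (B * (shift a * (B * x)))))) := by symm; rw [r2]
    _ = bullet (B * (B * B)) * (bullet (bullet b) * (bullet B * (B * (B * (B * (B * (shift a *
        (B * x)))))))) := by
      rw [← r3]
    _ = bullet (B * (B * B)) * (bullet (bullet b) * (shift B * (B * (B * (shift a * (B *
        x)))))) := by
      rw [r2]
    _ = bullet (B * (B * B)) * (B * (shift (bullet b) * (B * (B * (shift a * (B * x)))))) := by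
      symm; rw [← r4, r5]
    _ = bullet (B * (B * B)) * (shift (shift (bullet b)) * (B * (B * (B * (shift a * (B *
        x)))))) := by
      rw [← r6]
    _ = shift (bullet b) * (bullet (B * (B * B)) * (B * (B * (B * (shift a * (B * x)))))) := by
      symm; rw [r7]
    _ = shift (bullet b) * (bullet (B * (B * B)) * (B * (shift (shift (shift a)) * (B * (B * (B *
        x)))))) := by
      rw [← r8, ← r9]
    _ = shift (bullet b) * (shift (shift (shift a)) * (bullet (B * (B * B)) * (B * (B * (B * (B *
        x)))))) := by
      symm; rw [r10, r11]
    _ = shift (bullet b) * (shift (shift (shift a)) * (bullet B * (B * (bullet B * (B *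
        (bullet B * (B * (B * (B * (B * x)))))))))) := by
      rw [r12]
    _ = shift (bullet b) * (shift (shift (shift a)) * (bullet B * (shift (shift B) * (B *
        (bullet B * (B * (B * (B * x)))))))) := by
      rw [r2, ← r13, ← r14, ← r13]
    _ = shift (bullet b) * (shift (shift (shift a)) * (shift B * (shift B * (bullet B * (B * (B *
        x)))))) := by
      symm; rw [r14, r14, r13, ← r2]
    _ = _ := by rw [r15]

theorem traceOfDuality_exchange {a b : A} (ha : HasArity 0 2 a) (hb : HasArity 2 0 b) (s : Sgn) :
    traceOfDuality a b * traceOfDuality a b * sandwich (C s) (C s.opp) =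
      traceOfDuality a b * traceOfDuality a b := by
  have e1 : a * shift a * shift (shift (C s)) = (a * shift a * C s : A) := by
    have r1 := reassoc (congrArg shift (ha.slide₀₂' s))
    have r2 := reassoc (ha.natural₀₂ (a))
    have r3 := reassoc (ha.slide₀₂ s)
    simp only [mul_assoc, map_mul] at r1 r2 r3
    refine eq_of_forall_mul fun x => ?_
    simp only [mul_assoc]
    rw [← r1, ← r2, ← r3]
  have e2 : shift (shift (C s.opp)) * shift b * b = (C s.opp * shift b * b : A) := by
    have r1 := reassoc (congrArg shift (hb.slide₂₀' s))
    have r2 := reassoc (hb.natural₂₀ (b))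
    have r3 := reassoc (hb.slide₂₀ s)
    simp only [mul_assoc, map_mul] at r1 r2 r3
    refine eq_of_forall_mul fun x => ?_
    simp only [mul_assoc]
    rw [← r1, r2, ← r3]
  have h : traceOfDuality a b * traceOfDuality a b =
      sandwich (a * shift a) (shift b * b) * B * B := by
    rw [traceOfDuality_eq, ← sandwich_mul, mul_assoc, ← mul_assoc B, B_mul_sandwich]
    simp only [mul_assoc]
  calc traceOfDuality a b * traceOfDuality a b * sandwich (C s) (C s.opp)
      = sandwich (a * shift a) (shift b * b) *
          sandwich (shift (shift (C s))) (shift (shift (C s.opp))) * B * B := by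
        rw [h, mul_assoc _ B, B_mul_sandwich, ← mul_assoc, mul_assoc _ B, B_mul_sandwich]
        simp only [mul_assoc]
    _ = sandwich (a * shift a) (shift b * b) * (sandwich (C s) (C s.opp) * B * B) := by
        rw [sandwich_mul, e1, ← mul_assoc, e2]
        simp only [← mul_assoc]
        rw [sandwich_mul]
        simp only [mul_assoc]
    _ = traceOfDuality a b * traceOfDuality a b := by
        rw [sandwich_C_mul, h, mul_assoc]

end Sandwich

theorem IsRibbonDuality.isTraceCombinator {A : Type*} [BalancedExtBCpmIAlgebra A] {α β : A}
    (h : IsRibbonDuality α β) :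
    IsTraceCombinator (traceOfDuality (α ⊚ θ Sgn.plus ⊚ C Sgn.plus) β) := by
  have hα := h.toIsDuality.hasArity_unit
  have hβ := h.toIsDuality.hasArity_counit
  have d1 := h.toIsDuality.unit_mul_shift_counit
  have hθ (s : Sgn) : α * θ s = α * shift (θ s) := h.duality_θ s
  have h₁ (s : Sgn) : α * θ s * C s * shift (C s) * β = θ s := by
    have r1 := reassoc (hβ.cross₂₀ s)
    have r2 := reassoc ((hasArity_θ (A := A) s).natural₁₁ (β))
    have r3 := reassoc d1
    simp only [mul_assoc, one_mul] at r1 r2 r3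
    refine eq_of_forall_mul fun x => ?_
    simp only [mul_assoc]
    rw [← r1, ← r2, r3]
  have h₂ (s : Sgn) : α * θ s * C s * shift (C s.opp) * β = θ s.opp := by
    have r1 := reassoc (hβ.slide₂₀' s)
    have r2 := reassoc (congrArg shift (θ_mul_θ (A := A) s))
    have r3 := reassoc ((hasArity_θ (A := A) s).cross_left₁₁ s)
    have r4 := reassoc (hα.twist₀₂ s)
    have r5 := reassoc (hθ s.opp)
    have r6 := reassoc ((hasArity_θ (A := A) s.opp).natural₁₁ (β))
    have r7 := reassoc d1
    simp only [mul_assoc, map_mul, map_one, one_mul] at r1 r2 r3 r4 r5 r6 r7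
    refine eq_of_forall_mul fun x => ?_
    simp only [mul_assoc]
    calc _ = α * (θ s * (C s * (C s * (shift β * x)))) := by rw [← r1]
      _ = α * (θ s * (C s * (C s * (shift (θ s) * (shift (θ s.opp) * (shift β * x)))))) := by
        symm; rw [r2]
      _ = α * (θ s * (C s * (θ s * (C s * (shift (θ s.opp) * (shift β * x)))))) := by rw [← r3]
      _ = α * (shift (θ s.opp) * (shift β * x)) := by symm; rw [← r4]
      _ = α * (θ s.opp * (shift β * x)) := by rw [← r5]
      _ = _ := by rw [← r6, r7]
  have ha : HasArity 0 2 (α * θ Sgn.plus * C Sgn.plus) :=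
    (hα.mul (hasArity_θ Sgn.plus).succ).mul (hasArity_C Sgn.plus)
  rw [comp_eq_mul, comp_eq_mul, ← mul_assoc]
  constructor
  · intro t
    have := hasArity_traceOfDuality (b := β) ha
    rw [comp_eq_mul, comp_eq_mul, C_app_app, B_app, cpow_eq_pow]
    simpa only [HasArity, pow_succ, pow_zero, one_mul, mul_assoc] using this
  · intro t
    simpa only [comp_eq_mul, C_app_app, B_app, mul_assoc] using
      shift_traceOfDuality_mul (a := α * θ Sgn.plus * C Sgn.plus) hβ
  · intro s
    rw [traceOfDuality_app]
    cases s
    · exact h₁ Sgn.plus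
    · exact h₂ Sgn.plus
  · intro t
    have := traceOfDuality_exchange ha hβ Sgn.plus
    rw [cpow_eq_pow, pow_two, C_app_app]
    exact this

end BCpmI

theorem mainTheorem1 (A : Type*) [BalancedExtBCpmIAlgebra A] :
    (BCpmI.IsTraced A ↔ BCpmI.IsRibbon A) ∧
    (∀ Tr : A, BCpmI.IsTraceCombinator Tr →
      BCpmI.IsRibbonDuality (BCpmI.unitOfTrace Tr) (BCpmI.counitOfTrace Tr) ∧
      Tr = BCpmI.traceOfDuality (BCpmI.unitOfTrace Tr) (BCpmI.counitOfTrace Tr)) ∧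
    (∀ α β : A, BCpmI.IsRibbonDuality α β →
      BCpmI.IsTraceCombinator (BCpmI.traceOfDuality
        (α ⊚ BalancedExtBCpmIAlgebra.θ Sgn.plus ⊚ BCpmISignature.C Sgn.plus) β)) ∧
    (∀ α β : A, BCpmI.IsRibbonDuality α β →
      α ⊚ BalancedExtBCpmIAlgebra.θ Sgn.plus ⊚ BCpmISignature.C Sgn.plus = α →
      BCpmI.IsTraceCombinator (BCpmI.traceOfDuality α β)) := by
  refine ⟨⟨fun ⟨_, hT⟩ => ⟨_, _, hT.isRibbonDuality.1⟩,
    fun ⟨_, _, h⟩ => ⟨_, h.isTraceCombinator⟩⟩, fun _ hT => hT.isRibbonDuality,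
    fun _ _ h => h.isTraceCombinator, fun α β h hα => ?_⟩
  have := h.isTraceCombinator
  rwa [hα] at this
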